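/- All graphs are finite and simple, and "polynomial time" means time polynomial in the length of the input on a deterministic Turing machine (numbers in inputs and outputs are rationals written in binary). $(k,r)$-Independent-Set is the following search problem: given a $k$-colorable graph $G$ on $n$ vertices, find an independent set of $G$ of size at least $n/r$. For reals $p,\epsilon,c$ and integers $k,r$, $(k,r,p,\epsilon,c)$-Completion is the following search problem. The input is a symmetric partial matrix $A\in(\mathbb{Q}\cup\{\bot\})^{n\times n}$ whose set $\Omega=\{(i,j): A(i,j)\neq\bot\}$ of revealed positions satisfies $|\Omega|\ge pn^2$, with the promise that there is a symmetric real $n\times n$ matrix $M$ of rank $k$ such that $|M(i,j)|\le c$ for all $i,j$, and $M(i,j)=A(i,j)$ for all $(i,j)\in\Omega$. The output has to be an $n\times n$ matrix $B$ of rank at most $r$ such that $|B(i,j)|\le c$ for all $i,j$, and $\sum_{(i,j)\in\Omega}|A(i,j)-B(i,j)|^2\le \epsilon n$. The problem on matrices of coherence at most $\mu$ is the restriction to inputs for which $M$ can moreover be chosen with a singular value decomposition $M=U\Sigma V^\top$ (where $U,V\in\mathbb{R}^{n\times k}$ have orthonormal columns and $\Sigma$ is diagonal with positive diagonal entries) such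 that every row of $U$ and every row of $V$ has Euclidean norm at most $\sqrt{k\mu/n}$. **Theorem.** Assume that for all integers $r\ge k\ge 3$ there is no polynomial-time algorithm for $(k,r)$-Independent-Set. Then there is a constant $\mu$ such that for all integers $k\ge 4$ and $r>k$, and all reals $c>0$ and $0<\epsilon<1/(2cr)^2$, there is no polynomial-time algorithm that solves $(k,r,0.9,\epsilon,c)$-Completion on matrices of coherence at most $\mu$. -/

import Mathlib

/-! ### Search problems and polynomial time -/

/-- The finite alphabet in which instances and solutions are written. -/
inductive Letter
  | bit (b : Bool)
  | bot
  | minus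
  | slash
  | comma
  | newline
  deriving DecidableEq, Fintype

/-- A promise search problem: given an instance that satisfies the promise, find a solution of it.
Instances and candidate solutions are written as words over `Letter`. -/
structure SearchProblem where
  /-- instances -/
  Instance : Type
  /-- candidate solutions -/
  Candidate : Instance → Type
  /-- the inputs that an algorithm has to handle -/
  Promise : Instance → Prop
  /-- the correct outputs -/
  IsSolution : ∀ x, Candidate x → Prop
  /-- the word that represents an instance -/
  encodeInstance : Instance → List Letter
  /-- the word that represents a candidate solution -/
  encodeCandidate : ∀ x, Candidate x → List Letter

/-- The problem is solved by a polynomial-time algorithm: there are a Turing machine (in Mathlib's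
multi-stack formulation) and a polynomial such that, on the word of every instance that satisfies
the promise, the machine halts within the polynomial bound in the length of that word, and its
output is the word of a solution. -/
def SearchProblem.SolvableInPolyTime (Q : SearchProblem) : Prop :=
  ∃ (T : Turing.TM2ComputableAux Letter Letter) (time : Polynomial ℕ),
    ∀ x : Q.Instance, Q.Promise x →
      ∃ y : Q.Candidate x, Q.IsSolution x y ∧
        Nonempty (Turing.TM2OutputsInTime T.tm
          ((Q.encodeInstance x).map T.inputAlphabet.symm)
          (some ((Q.encodeCandidate x y).map T.outputAlphabet.symm))
          (time.eval (Q.encodeInstance x).length))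

/-! ### Words for numbers, matrices and sets of vertices -/

/-- Binary representation, least significant bit first. -/
def encodeNatural (m : ℕ) : List Letter := m.bits.map Letter.bit

/-- A rational number in lowest terms: sign, numerator and denominator in binary. -/
def encodeRational (q : ℚ) : List Letter :=
  (if q < 0 then [Letter.minus] else []) ++ encodeNatural q.num.natAbs ++
    [Letter.slash] ++ encodeNatural q.den

/-- A revealed entry is a rational number, a hidden entry is the symbol `⊥`. -/
def encodeEntry : Option ℚ → List Letter
  | none => [Letter.bot]
  | some q => encodeRational q

/-- A square matrix, row by row; `e` writes a single entry. -/
def encodeMatrix {α : Type} {n : ℕ} (e : α → List Letter) (A : Matrix (Fin n) (Fin n) α) :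
    List Letter :=
  (List.ofFn fun i : Fin n =>
    (List.ofFn fun j : Fin n => e (A i j) ++ [Letter.comma]).flatten ++ [Letter.newline]).flatten

open Classical in
/-- A graph, through its adjacency matrix. -/
noncomputable def encodeGraph {n : ℕ} (G : SimpleGraph (Fin n)) : List Letter :=
  encodeMatrix (fun b : Bool => [Letter.bit b]) (fun i j => decide (G.Adj i j))

/-- A set of vertices, through its indicator vector. -/
def encodeVertexSet {n : ℕ} (T : Finset (Fin n)) : List Letter :=
  List.ofFn fun i : Fin n => Letter.bit (decide (i ∈ T))

/-! ### Independent sets in colorable graphs -/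

/-- Given a `k`-colorable graph on `n` vertices, find an independent set with at least `n / r`
vertices. -/
noncomputable def independentSetProblem (k r : ℕ) : SearchProblem where
  Instance := Σ n : ℕ, SimpleGraph (Fin n)
  Candidate x := Finset (Fin x.1)
  Promise x := x.2.Colorable k
  IsSolution x T := x.2.IsIndepSet (T : Set (Fin x.1)) ∧ (x.1 : ℝ) / r ≤ (T.card : ℝ)
  encodeInstance x := encodeGraph x.2
  encodeCandidate _ T := encodeVertexSet T

/-! ### Matrix completion -/

/-- The set of revealed positions of a partial matrix (`none` stands for `⊥`). -/
def revealed {n : ℕ} (A : Matrix (Fin n) (Fin n) (Option ℚ)) : Finset (Fin n × Fin n) :=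
  Finset.univ.filter fun ij => (A ij.1 ij.2).isSome

/-- The real matrix `M` agrees with the partial matrix `A` on the revealed positions. -/
def Completes {n : ℕ} (M : Matrix (Fin n) (Fin n) ℝ) (A : Matrix (Fin n) (Fin n) (Option ℚ)) :
    Prop :=
  ∀ i j q, A i j = some q → M i j = (q : ℝ)

/-- The total squared error of `B` over the revealed positions of `A`. The default value of `getD`
is never used, as `A` has a value at each revealed position. -/
noncomputable def squaredError {n : ℕ} (A : Matrix (Fin n) (Fin n) (Option ℚ))
    (B : Matrix (Fin n) (Fin n) ℝ) : ℝ :=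
  ∑ ij ∈ revealed A, |(((A ij.1 ij.2).getD 0 : ℚ) : ℝ) - B ij.1 ij.2| ^ 2

/-- The `n × n` matrix `M` of rank `k` has coherence (at most) `μ`: there is a singular value
decomposition `M = U Σ Vᵀ`, where `U` and `V` are `n × k` matrices with orthonormal columns and `Σ`
is diagonal with positive entries, such that all rows of `U` and `V` have Euclidean norm at most
`√(k μ / n)`. -/
def HasCoherence {n : ℕ} (M : Matrix (Fin n) (Fin n) ℝ) (k : ℕ) (μ : ℝ) : Prop :=
  ∃ (U V : Matrix (Fin n) (Fin k) ℝ) (s : Fin k → ℝ),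
    U.transpose * U = 1 ∧ V.transpose * V = 1 ∧ (∀ l, 0 < s l) ∧
    M = U * Matrix.diagonal s * V.transpose ∧
    (∀ i, √(∑ l, U i l ^ 2) ≤ √(k * μ / n)) ∧
    (∀ i, √(∑ l, V i l ^ 2) ≤ √(k * μ / n))

/-- Matrix completion with parameters `(k, r, p, ε, c)` on matrices of coherence at most `μ`.

The instance is a symmetric partial matrix `A` with at least `p n²` revealed entries, such that some
symmetric real matrix of rank `k` and coherence at most `μ`, with entries bounded by `c`, agrees
with `A` on the revealed positions. A solution is a matrix `B` of rank at most `r`, with entries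
bounded by `c`, whose total squared error over the revealed positions is at most `ε n`.
As the algorithms are Turing machines, the entries of `A` and `B` are rational; the hidden matrix is
real. -/
noncomputable def completionProblem (k r : ℕ) (p ε c μ : ℝ) : SearchProblem where
  Instance := Σ n : ℕ, Matrix (Fin n) (Fin n) (Option ℚ)
  Candidate x := Matrix (Fin x.1) (Fin x.1) ℚ
  Promise x :=
    x.2.IsSymm ∧ p * (x.1 : ℝ) ^ 2 ≤ ((revealed x.2).card : ℝ) ∧
      ∃ M : Matrix (Fin x.1) (Fin x.1) ℝ,
        M.IsSymm ∧ M.rank = k ∧ HasCoherence M k μ ∧ (∀ i j, |M i j| ≤ c) ∧ Completes M x.2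
  IsSolution x B :=
    (B.map ((↑) : ℚ → ℝ)).rank ≤ r ∧ (∀ i j, |(B i j : ℝ)| ≤ c) ∧
      squaredError x.2 (B.map ((↑) : ℚ → ℝ)) ≤ ε * x.1
  encodeInstance x := encodeMatrix encodeEntry x.2
  encodeCandidate _ B := encodeMatrix encodeRational B

/-!
Padding a `k`-colorable graph with isolated vertices, grouped in large color classes, gives a
completion instance: the hidden matrix has the entry `d` at the pairs of equal color and `0`
elsewhere, the diagonal, the edges and all pairs of added vertices are revealed, and the non-edges
are hidden. The added classes account for almost all entries and make the hidden matrix incoherent,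
so any fraction `p < 1` of revealed entries and any coherence `μ > 1` can be reached. The graph is
repeated `t` times: the error allowed is linear in the size, and there are `t²` pairs of copies, so
in some pair of copies the error is small compared with the number of vertices, whatever `ε` is.

In such a pair, at least half of the rows are accurate at all their revealed entries. As a bounded
matrix of rank `r` has only boundedly many rows up to a given precision, the rows of a constant
fraction of the vertices are close to a single row `y`. For each such vertex `i`, `y i` is close to
`d`, while `y j` is close to `0` for the neighbors `j` of `i`. Thresholding `y` and discarding the
vertices with a neighbor above the threshold leaves an independent set of linear size. The
reduction tries all rows, and runs as a program with finitely many stacks in polynomial time.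
-/

open Turing
open scoped Finset

/-! ### Structured programs and their compilation to multi-stack machines -/

section Machine

theorem initList_eq (tm : FinTM2) (w : List (tm.Γ tm.k₀)) :
    initList tm w = ⟨some tm.main, tm.initialState, Function.update (fun _ => []) tm.k₀ w⟩ := by
  rw [initList]
  congr 1
  funext k
  by_cases h : k = tm.k₀
  · subst h
    simp
  · simp [h]

theorem haltList_eq (tm : FinTM2) (w : List (tm.Γ tm.k₁)) :
    haltList tm w = ⟨none, tm.initialState, Function.update (fun _ => []) tm.k₁ w⟩ := by
  rw [haltList]
  congr 1
  funext k
  by_cases h : k = tm.k₁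
  · subst h
    simp
  · simp [h]

variable {K : Type} [DecidableEq K] {Γ : K → Type} {Λ σ : Type}

/-- The machine with transition table `M` gets from the configuration `c` to `c'` in exactly `n`
steps. -/
def StepsTo (M : Λ → TM2.Stmt Γ Λ σ) (n : ℕ) (c c' : TM2.Cfg Γ Λ σ) : Prop :=
  (flip bind (TM2.step M))^[n] (some c) = some c'

namespace StepsTo

variable {M : Λ → TM2.Stmt Γ Λ σ} {c c₁ c₂ : TM2.Cfg Γ Λ σ} {m n : ℕ}

theorem zero_iff : StepsTo M 0 c c₁ ↔ c = c₁ := Option.some_inj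

theorem refl : StepsTo M 0 c c := rfl

theorem trans (h : StepsTo M m c c₁) (h' : StepsTo M n c₁ c₂) : StepsTo M (m + n) c c₂ := by
  rw [StepsTo, add_comm, Function.iterate_add_apply, show _ = some c₁ from h, h']

theorem succ_iff :
    StepsTo M (n + 1) c c₂ ↔ ∃ c₁, StepsTo M n c c₁ ∧ TM2.step M c₁ = some c₂ := by
  rw [StepsTo, Function.iterate_succ_apply']
  exact Option.bind_eq_some_iff

theorem single (h : TM2.step M c = some c₁) : StepsTo M 1 c c₁ := h

end StepsTo

end Machine

/-- The registers of a structured program over the alphabet `α`. -/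
structure Reg (α : Type) where
  /-- the letter read last -/
  cur : Option α
  /-- first flag -/
  flag : Bool
  /-- second flag -/
  aux : Bool
  deriving Fintype

/-- The contents of the registers when a program starts. -/
abbrev Reg.init {α : Type} : Reg α := ⟨none, false, false⟩

/-- Structured programs on stacks of letters of `α`, the stacks being indexed by `K`. The
instructions `give`, `call` and `take` hand a letter to a subroutine, run it, and take a letter from
its output. -/
inductive Prog (α K : Type)
  | load (f : Reg α → Reg α)
  | push (k : K) (f : Reg α → α)
  | pop (k : K)
  | give (f : Reg α → α)
  | take
  | call
  | seq (p q : Prog α K)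
  | ite (b : Reg α → Bool) (p q : Prog α K)
  | loop (b : Reg α → Bool) (p : Prog α K)

infixr:60 ";;" => Prog.seq

section Semantics

variable {α K : Type} [DecidableEq K] (T : TM2ComputableAux α α)

/-- The memory of a structured program with subroutine `T`. -/
structure Mem (K : Type) where
  /-- registers -/
  reg : Reg α
  /-- work stacks -/
  store : K → List α
  /-- stacks of the subroutine -/
  stk : ∀ j, List (T.tm.Γ j)

/-- Big-step semantics of structured programs with subroutine `T`. The number counts the steps of
the compiled machine, which does all straight-line code up to the next jump in a single step. -/
inductive Exec : Prog α K → Mem T K → Mem T K → ℕ → Prop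
  | load (f) (m : Mem T K) : Exec (.load f) m { m with reg := f m.reg } 0
  | push (k f) (m : Mem T K) :
      Exec (.push k f) m
        { m with store := Function.update m.store k (f m.reg :: m.store k) } 0
  | pop (k) (m : Mem T K) :
      Exec (.pop k) m
        { m with
          reg := { m.reg with cur := (m.store k).head? }
          store := Function.update m.store k (m.store k).tail } 0
  | give (f) (m : Mem T K) :
      Exec (.give f) m
        { m with
          stk := Function.update m.stk T.tm.k₀
            (T.inputAlphabet.symm (f m.reg) :: m.stk T.tm.k₀) } 0
  | take (m : Mem T K) :
      Exec .take m
        { m with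
          reg := { m.reg with cur := (m.stk T.tm.k₁).head?.map T.outputAlphabet }
          stk := Function.update m.stk T.tm.k₁ (m.stk T.tm.k₁).tail } 0
  | call (n) (m : Mem T K) (S : ∀ j, List (T.tm.Γ j))
      (h : StepsTo T.tm.m n ⟨some T.tm.main, T.tm.initialState, m.stk⟩
        ⟨none, T.tm.initialState, S⟩) :
      Exec .call m { m with stk := S } n
  | seq {p q m₁ m₂ m₃ c d} : Exec p m₁ m₂ c → Exec q m₂ m₃ d → Exec (p ;; q) m₁ m₃ (c + d)
  | ite_true {b p q m₁ m₂ c} : b m₁.reg = true → Exec p m₁ m₂ c → Exec (.ite b p q) m₁ m₂ c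
  | ite_false {b p q m₁ m₂ c} : b m₁.reg = false → Exec q m₁ m₂ c → Exec (.ite b p q) m₁ m₂ c
  | loop_exit {b p} {m : Mem T K} : b m.reg = false → Exec (.loop b p) m m 1
  | loop_step {b p m₁ m₂ m₃ c d} : b m₁.reg = true → Exec p m₁ m₂ c → Exec (.loop b p) m₂ m₃ d →
      Exec (.loop b p) m₁ m₃ (1 + (c + d))

variable (K) in
/-- The alphabets of the stacks of a compiled machine: the work stacks, and those of the
subroutine. -/
abbrev JointAlphabet : K ⊕ T.tm.K → Type
  | .inl _ => α
  | .inr j => T.tm.Γ j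

variable (K) in
/-- The statements of a compiled machine with labels `Λ`. -/
abbrev Code (Λ : Type) : Type := TM2.Stmt (JointAlphabet K T) Λ (Reg α × T.tm.σ)

/-- The stacks of a compiled machine. -/
def jointStacks (s : K → List α) (S : ∀ j, List (T.tm.Γ j)) : ∀ k, List (JointAlphabet K T k)
  | .inl k => s k
  | .inr j => S j

omit [DecidableEq K] in
theorem jointStacks_nil : jointStacks T (fun _ : K => []) (fun _ => []) = fun _ => [] := by
  funext k
  cases k <;> rfl

/-- A statement of the subroutine as part of a compiled machine; where the subroutine halts, it
continues with `k`. -/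
def embedStmt {Λ : Type} (e : T.tm.Λ → Λ) (k : Code K T Λ) :
    TM2.Stmt T.tm.Γ T.tm.Λ T.tm.σ → Code K T Λ
  | .push j f q => .push (.inr j) (fun v => f v.2) (embedStmt e k q)
  | .peek j f q => .peek (.inr j) (fun v x => (v.1, f v.2 x)) (embedStmt e k q)
  | .pop j f q => .pop (.inr j) (fun v x => (v.1, f v.2 x)) (embedStmt e k q)
  | .load f q => .load (fun v => (v.1, f v.2)) (embedStmt e k q)
  | .branch f q₁ q₂ => .branch (fun v => f v.2) (embedStmt e k q₁) (embedStmt e k q₂)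
  | .goto f => .goto (fun v => e (f v.2))
  | .halt => k

namespace Prog

/-- The labels of the compiled machine that belong to a program: one for each loop, and those of the
subroutine for each call. -/
def Label : Prog α K → Type
  | .load _ | .push _ _ | .pop _ | .give _ | .take => Empty
  | .call => T.tm.Λ
  | .seq p q | .ite _ p q => p.Label ⊕ q.Label
  | .loop _ p => Option p.Label

/-- A program has finitely many labels. -/
@[reducible] def fintypeLabel : ∀ p : Prog α K, Fintype (p.Label T)
  | .load _ | .push _ _ | .pop _ | .give _ | .take => inferInstanceAs (Fintype Empty)
  | .call => T.tm.ΛFin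
  | .seq p q | .ite _ p q =>
    letI := p.fintypeLabel
    letI := q.fintypeLabel
    inferInstanceAs (Fintype (p.Label T ⊕ q.Label T))
  | .loop _ p =>
    letI := p.fintypeLabel
    inferInstanceAs (Fintype (Option (p.Label T)))

/-- The statement that starts `p` and then continues with `k`; the labels of `p` are placed by
`e`. -/
def code {Λ : Type} : ∀ p : Prog α K, (p.Label T → Λ) → Code K T Λ → Code K T Λ
  | .load f, _, k => .load (fun v => (f v.1, v.2)) k
  | .push i f, _, k => .push (.inl i) (fun v => f v.1) k
  | .pop i, _, k => .pop (.inl i) (fun v x => ({ v.1 with cur := x }, v.2)) k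
  | .give f, _, k => .push (.inr T.tm.k₀) (fun v => T.inputAlphabet.symm (f v.1)) k
  | .take, _, k =>
    .pop (.inr T.tm.k₁) (fun v x => ({ v.1 with cur := x.map T.outputAlphabet }, v.2)) k
  | .call, e, _ => .goto (fun _ => e T.tm.main)
  | .seq p q, e, k => p.code (e ∘ Sum.inl) (q.code (e ∘ Sum.inr) k)
  | .ite b p q, e, k => .branch (fun v => b v.1) (p.code (e ∘ Sum.inl) k) (q.code (e ∘ Sum.inr) k)
  | .loop _ _, e, _ => .goto (fun _ => e none)

/-- The statements at the labels of `p`, if `p` is followed by `k`. -/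
def table {Λ : Type} : ∀ p : Prog α K, (p.Label T → Λ) → Code K T Λ → p.Label T → Code K T Λ
  | .load _, _, _ | .push _ _, _, _ | .pop _, _, _ | .give _, _, _ | .take, _, _ => Empty.elim
  | .call, e, k => fun l => embedStmt T e k (T.tm.m l)
  | .seq p q, e, k =>
    Sum.elim (p.table (e ∘ Sum.inl) (q.code T (e ∘ Sum.inr) k)) (q.table (e ∘ Sum.inr) k)
  | .ite _ p q, e, k => Sum.elim (p.table (e ∘ Sum.inl) k) (q.table (e ∘ Sum.inr) k)
  | .loop b p, e, k => fun l =>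
    Option.elim l (.branch (fun v => b v.1)
      (p.code T (e ∘ some) (.goto fun _ => e none)) k)
      (p.table (e ∘ some) (.goto fun _ => e none))

end Prog

variable {T}

theorem update_jointStacks_inl (s : K → List α) (S : ∀ j, List (T.tm.Γ j)) (k : K) (w : List α) :
    Function.update (jointStacks T s S) (.inl k) w = jointStacks T (Function.update s k w) S := by
  funext j
  rcases j with j | j
  · rcases eq_or_ne j k with rfl | h
    · simp [jointStacks]
    · rw [Function.update_of_ne (by simpa using h)]
      simp [jointStacks, Function.update_of_ne h]
  · rw [Function.update_of_ne Sum.inr_ne_inl]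
    rfl

theorem update_jointStacks_inr (s : K → List α) (S : ∀ j, List (T.tm.Γ j)) (k : T.tm.K)
    (w : List (T.tm.Γ k)) :
    Function.update (jointStacks T s S) (.inr k) w = jointStacks T s (Function.update S k w) := by
  funext j
  rcases j with j | j
  · rw [Function.update_of_ne Sum.inl_ne_inr]
    rfl
  · rcases eq_or_ne j k with rfl | h
    · simp [jointStacks]
    · rw [Function.update_of_ne (by simpa using h)]
      simp [jointStacks, Function.update_of_ne h]

/-- The configuration of a compiled machine that corresponds to the configuration `c` of the
subroutine. If the subroutine has halted, then the statement `k` that follows the call has already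
been executed, since a halt is not a step of its own. -/
def embedCfg {Λ : Type} (e : T.tm.Λ → Λ) (k : Code K T Λ) (r : Reg α) (s : K → List α)
    (c : TM2.Cfg T.tm.Γ T.tm.Λ T.tm.σ) : TM2.Cfg (JointAlphabet K T) Λ (Reg α × T.tm.σ) :=
  match c.l with
  | some l => ⟨some (e l), (r, c.var), jointStacks T s c.stk⟩
  | none => TM2.stepAux k (r, c.var) (jointStacks T s c.stk)

section

variable {Λ : Type} (e : T.tm.Λ → Λ) (k : Code K T Λ) (r : Reg α) (s : K → List α)

theorem stepAux_embedStmt (q : TM2.Stmt T.tm.Γ T.tm.Λ T.tm.σ) (v : T.tm.σ)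
    (S : ∀ j, List (T.tm.Γ j)) :
    TM2.stepAux (embedStmt T e k q) (r, v) (jointStacks T s S) =
      embedCfg e k r s (TM2.stepAux q v S) := by
  induction q generalizing v S with
  | push j f q ih => simp only [embedStmt, TM2.stepAux, update_jointStacks_inr, ← ih]; rfl
  | peek j f q ih => simp only [embedStmt, TM2.stepAux, ← ih]; rfl
  | pop j f q ih => simp only [embedStmt, TM2.stepAux, update_jointStacks_inr, ← ih]; rfl
  | load f q ih => simp only [embedStmt, TM2.stepAux, ← ih]
  | branch f q₁ q₂ ih₁ ih₂ =>
    simp only [embedStmt, TM2.stepAux, ih₁, ih₂]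
    cases f v <;> rfl
  | goto f => rfl
  | halt => rfl

theorem StepsTo.embedCfg {M : Λ → Code K T Λ} (hM : ∀ l, M (e l) = embedStmt T e k (T.tm.m l))
    {n : ℕ} {c c' : TM2.Cfg T.tm.Γ T.tm.Λ T.tm.σ} (h : StepsTo T.tm.m n c c') :
    StepsTo M n (embedCfg e k r s c) (embedCfg e k r s c') := by
  induction n generalizing c' with
  | zero => rw [StepsTo.zero_iff.1 h]; exact .refl
  | succ n ih =>
    obtain ⟨⟨_ | l, v, S⟩, hd, hstep⟩ := StepsTo.succ_iff.1 h
    · cases hstep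
    · refine StepsTo.succ_iff.2 ⟨_, ih hd, ?_⟩
      rw [← Option.some.inj hstep, ← stepAux_embedStmt, ← hM]
      rfl

end

theorem stepsTo_loop {Λ : Type} {M : Λ → Code K T Λ} {b : Reg α → Bool} {p : Prog α K}
    {e : (Prog.loop b p).Label T → Λ} {k : Code K T Λ}
    (hM : ∀ l, M (e l) = (Prog.loop b p).table T e k l) (r : Reg α) (v : T.tm.σ)
    (S : ∀ k, List (JointAlphabet K T k)) :
    StepsTo M 1 (TM2.stepAux ((Prog.loop b p).code T e k) (r, v) S)
      (TM2.stepAux (bif b r then p.code T (e ∘ some) (.goto fun _ => e none) else k) (r, v) S) := by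
  refine .single ?_
  simp only [Prog.code, TM2.stepAux, TM2.step, hM none, Prog.table, Option.elim]
  cases b r <;> rfl

theorem Exec.stepsTo {p : Prog α K} {m m' : Mem T K} {n : ℕ} (h : Exec T p m m' n) {Λ : Type}
    {M : Λ → Code K T Λ} {e : p.Label T → Λ} {k : Code K T Λ}
    (hM : ∀ l, M (e l) = p.table T e k l) :
    StepsTo M n
      (TM2.stepAux (p.code T e k) (m.reg, T.tm.initialState) (jointStacks T m.store m.stk))
      (TM2.stepAux k (m'.reg, T.tm.initialState) (jointStacks T m'.store m'.stk)) := by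
  induction h generalizing k with
  | load f m => exact .refl
  | push i f m | pop i m =>
    simp only [Prog.code, TM2.stepAux, update_jointStacks_inl]
    exact .refl
  | give f m | take m =>
    simp only [Prog.code, TM2.stepAux, update_jointStacks_inr]
    exact .refl
  | call n m S h => exact h.embedCfg e k m.reg m.store hM
  | seq _ _ ih₁ ih₂ => exact (ih₁ fun l => hM (.inl l)).trans (ih₂ fun l => hM (.inr l))
  | ite_true hb _ ih =>
    simp only [Prog.code, TM2.stepAux, hb, cond_true]
    exact ih fun l => hM (.inl l)
  | ite_false hb _ ih =>
    simp only [Prog.code, TM2.stepAux, hb, cond_false]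
    exact ih fun l => hM (.inr l)
  | @loop_exit b p m hb => simpa only [hb, cond_false] using stepsTo_loop hM m.reg _ _
  | @loop_step b p m₁ m₂ m₃ c d hb _ _ ih₁ ih₂ =>
    have hstep := stepsTo_loop hM m₁.reg T.tm.initialState (jointStacks T m₁.store m₁.stk)
    rw [hb, cond_true] at hstep
    exact hstep.trans ((ih₁ fun l => hM (some l)).trans (ih₂ hM))

variable [Fintype α] [Fintype K]

variable (T) in
/-- The machine that runs a structured program with subroutine `T`; its input and its output are on
the work stacks `i` and `o`. -/
def Prog.computer (p : Prog α K) (i o : K) : TM2ComputableAux α α where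
  tm :=
    letI := p.fintypeLabel T
    letI := T.tm.kFin
    letI := T.tm.σFin
    { K := K ⊕ T.tm.K
      k₀ := .inl i
      k₁ := .inl o
      Γ := JointAlphabet K T
      Λ := Option (p.Label T)
      main := none
      σ := Reg α × T.tm.σ
      initialState := (.init, T.tm.initialState)
      Γk₀Fin := inferInstanceAs (Fintype α)
      m := fun l => l.elim (p.code T some .halt) (p.table T some .halt) }
  inputAlphabet := Equiv.refl α
  outputAlphabet := Equiv.refl α

theorem Exec.outputsInTime {p : Prog α K} {i o : K} {w v : List α} {n N : ℕ}
    (h : Exec T p ⟨.init, Function.update (fun _ => []) i w, fun _ => []⟩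
      ⟨.init, Function.update (fun _ => []) o v, fun _ => []⟩ n) (hn : n + 1 ≤ N) :
    Nonempty (TM2OutputsInTime (p.computer T i o).tm
      (w.map (p.computer T i o).inputAlphabet.symm)
      (some (v.map (p.computer T i o).outputAlphabet.symm)) N) := by
  have hrun := h.stepsTo (M := (p.computer T i o).tm.m) (e := some) (k := .halt) fun _ => rfl
  rw [← update_jointStacks_inl, ← update_jointStacks_inl, jointStacks_nil, ← List.map_id w,
    ← List.map_id v] at hrun
  refine ⟨⟨⟨n + 1, ?_⟩, hn⟩⟩
  rw [initList_eq, Option.map_some, haltList_eq, Function.iterate_succ_apply]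
  exact hrun

end Semantics

/-! ### Program logic -/

section ProgramLogic

variable {α K : Type} [DecidableEq K]

/-- `p` leads from registers `r` and work stacks `s` to `r'` and `s'` with at most `c` jumps, and
leaves the stacks of the subroutine as they are. -/
def Runs (p : Prog α K) (r : Reg α) (s : K → List α) (r' : Reg α) (s' : K → List α) (c : ℕ) :
    Prop :=
  ∀ (T : TM2ComputableAux α α) (S : ∀ j, List (T.tm.Γ j)),
    ∃ n ≤ c, Exec T p ⟨r, s, S⟩ ⟨r', s', S⟩ n

namespace Runs

variable {p q : Prog α K} {r r₁ r₂ r₃ : Reg α} {s s₁ s₂ s₃ : K → List α} {c d : ℕ}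

theorem mono (h : Runs p r s r₁ s₁ c) (hcd : c ≤ d) : Runs p r s r₁ s₁ d := fun T S =>
  let ⟨n, hn, he⟩ := h T S
  ⟨n, hn.trans hcd, he⟩

theorem of_eq (h : Runs p r s r₁ s₁ c) (hr : r₁ = r₂) (hs : s₁ = s₂) (hcd : c ≤ d) :
    Runs p r s r₂ s₂ d :=
  hr ▸ hs ▸ h.mono hcd

theorem seq (h : Runs p r s r₁ s₁ c) (h' : Runs q r₁ s₁ r₂ s₂ d) :
    Runs (p ;; q) r s r₂ s₂ (c + d) := fun T S =>
  let ⟨_, hn, he⟩ := h T S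
  let ⟨_, hn', he'⟩ := h' T S
  ⟨_, add_le_add hn hn', he.seq he'⟩

theorem seq_of_eq (h : Runs p r s r₁ s₁ c) (h' : Runs q r₂ s₂ r₃ s₃ d) (hr : r₁ = r₂)
    (hs : s₁ = s₂) : Runs (p ;; q) r s r₃ s₃ (c + d) :=
  h.seq (hr ▸ hs ▸ h')

theorem ite_true {b : Reg α → Bool} (hb : b r = true) (h : Runs p r s r₁ s₁ c) :
    Runs (.ite b p q) r s r₁ s₁ c := fun T S =>
  let ⟨_, hn, he⟩ := h T S
  ⟨_, hn, .ite_true hb he⟩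

theorem ite_false {b : Reg α → Bool} (hb : b r = false) (h : Runs q r s r₁ s₁ c) :
    Runs (.ite b p q) r s r₁ s₁ c := fun T S =>
  let ⟨_, hn, he⟩ := h T S
  ⟨_, hn, .ite_false hb he⟩

theorem load (f : Reg α → Reg α) : Runs (.load f) r s (f r) s 0 :=
  fun _ _ => ⟨_, le_rfl, .load _ _⟩

theorem push (k : K) (f : Reg α → α) :
    Runs (.push k f) r s r (Function.update s k (f r :: s k)) 0 :=
  fun _ _ => ⟨_, le_rfl, .push _ _ _⟩

theorem pop (k : K) :
    Runs (.pop k) r s { r with cur := (s k).head? } (Function.update s k (s k).tail) 0 :=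
  fun _ _ => ⟨_, le_rfl, .pop _ _⟩

end Runs

namespace Prog

/-- Was `a` the letter read last? -/
def isCur [DecidableEq α] (a : α) (r : Reg α) : Bool := decide (r.cur = some a)

/-- Do nothing. -/
def skip : Prog α K := .load id

/-- Push a fixed letter. -/
def pushLetter (k : K) (a : α) : Prog α K := .push k fun _ => a

/-- Empty the stack `k` letter by letter and execute `p` after each letter. -/
def forPop (k : K) (p : Prog α K) : Prog α K :=
  .pop k ;; .loop (fun r => r.cur.isSome) (p ;; .pop k)

/-- Execute a program for each element of a fixed list. -/
def forList {ι : Type} (l : List ι) (f : ι → Prog α K) : Prog α K :=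
  l.foldr (fun a p => f a ;; p) skip

/-- Push a fixed word, so that its last letter ends up on top. -/
def pushWord (k : K) (w : List α) : Prog α K := forList w (pushLetter k)

/-- Empty a stack. -/
def clear (k : K) : Prog α K := forPop k skip

/-- Take the output of the subroutine letter by letter and execute `p` after each letter. -/
def forTake (p : Prog α K) : Prog α K := .take ;; .loop (fun r => r.cur.isSome) (p ;; .take)

variable [Inhabited α]

/-- Push the letter read last; the default letter is never used. -/
def pushCur (k : K) : Prog α K := .push k fun r => r.cur.getD default

/-- Move the content of a stack to another one, which reverses it. -/
def move (k j : K) : Prog α K := forPop k (pushCur j)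

/-- Call the subroutine on the reverse of the stack `i`, and move its output to `o`. -/
def invoke (i o : K) : Prog α K :=
  forPop i (.give fun r => r.cur.getD default) ;; .call ;; forTake (pushCur i) ;; move i o

end Prog

open Prog

variable {p : Prog α K} {k : K}

section Exec

variable {T : TM2ComputableAux α α}

theorem Exec.forPop_cons {m m₁ m₂ : Mem T K} {a : α} {v : List α} {c d : ℕ}
    (hs : m.store k = a :: v)
    (h : Exec T p ⟨{ m.reg with cur := some a }, Function.update m.store k v, m.stk⟩ m₁ c)
    (h' : Exec T (forPop k p) m₁ m₂ d) : Exec T (forPop k p) m m₂ (c + d + 1) := by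
  cases h' with
  | @seq _ _ _ m' _ x y h₁ h₂ =>
    rw [show c + (x + y) + 1 = 0 + (1 + ((c + x) + y)) by omega]
    refine (Exec.pop k _).seq (.loop_step (m₂ := m') ?_ (.seq (m₂ := m₁) ?_ h₁) h₂)
    · simp [hs]
    · simpa [hs] using h

theorem Exec.forPop_nil {m : Mem T K} (hs : m.store k = []) :
    Exec T (forPop k p) m { m with reg := { m.reg with cur := none } } 1 := by
  have hpop := Exec.pop k m
  rw [hs, List.tail_nil, ← hs, Function.update_eq_self, hs] at hpop
  exact zero_add 1 ▸ hpop.seq (.loop_exit rfl)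

end Exec

namespace Runs

variable {r r' r₁ r₂ : Reg α} {s s' s₁ s₂ : K → List α} {c d : ℕ}

theorem skip : Runs Prog.skip r s r s 0 := load id

theorem forPop_cons {a : α} {v : List α} (hs : s k = a :: v)
    (h : Runs p { r with cur := some a } (Function.update s k v) r₁ s₁ c)
    (h' : Runs (forPop k p) r₁ s₁ r₂ s₂ d) : Runs (forPop k p) r s r₂ s₂ (c + d + 1) := fun T S =>
  let ⟨_, hn, he⟩ := h T S
  let ⟨_, hm, he'⟩ := h' T S
  ⟨_, by omega, .forPop_cons hs he he'⟩

theorem forPop_nil (hs : s k = []) : Runs (forPop k p) r s { r with cur := none } s 1 :=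
  fun _ _ => ⟨1, le_rfl, .forPop_nil hs⟩

theorem forPop_cur {x : Option α} (h : Runs (forPop k p) r s r' s' c) :
    Runs (forPop k p) { r with cur := x } s r' s' c := by
  intro T S
  obtain ⟨n, hn, he⟩ := h T S
  refine ⟨n, hn, ?_⟩
  cases he with
  | seq h₁ h₂ =>
    cases h₁
    exact (Exec.pop k _).seq h₂

end Runs

/-- The loop `forPop k p` consumes the top part `w` of the stack `k`, which leads from `r` and `s`
to `r'` and `s'`; what `s` and `s'` have on the stack `k` is irrelevant. -/
def Consumes (k : K) (p : Prog α K) (w : List α) (r : Reg α) (s : K → List α) (r' : Reg α)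
    (s' : K → List α) (c : ℕ) : Prop :=
  ∀ v r'' s'' d, Runs (forPop k p) r' (Function.update s' k v) r'' s'' d →
    Runs (forPop k p) r (Function.update s k (w ++ v)) r'' s'' (c + d)

namespace Consumes

variable {v w : List α} {r r₁ r₂ : Reg α} {s s₁ s₂ : K → List α} {c d : ℕ}

theorem nil : Consumes k p [] r s r s 0 := fun v r'' s'' d h => by simpa using h

theorem mono (h : Consumes k p w r s r₁ s₁ c) (hcd : c ≤ d) : Consumes k p w r s r₁ s₁ d :=
  fun v r'' s'' d' h' => (h v r'' s'' d' h').mono (by omega)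

theorem of_eq (h : Consumes k p w r s r₁ s₁ c) (hr : r₁ = r₂) (hs : s₁ = s₂) (hcd : c ≤ d) :
    Consumes k p w r s r₂ s₂ d :=
  hr ▸ hs ▸ h.mono hcd

theorem append (h : Consumes k p v r s r₁ s₁ c) (h' : Consumes k p w r₁ s₁ r₂ s₂ d) :
    Consumes k p (v ++ w) r s r₂ s₂ (c + d) := fun u r'' s'' d' hd => by
  rw [List.append_assoc, add_assoc]
  exact h (w ++ u) r'' s'' _ (h' u r'' s'' d' hd)

theorem single {a : α}
    (h : ∀ v, ∃ x, Runs p { r with cur := some a } (Function.update s k v) { r₁ with cur := x }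
      (Function.update s₁ k v) c) :
    Consumes k p [a] r s r₁ s₁ (c + 1) := by
  intro v r'' s'' d hd
  obtain ⟨x, hx⟩ := h v
  refine (Runs.forPop_cons (a := a) (v := v) (by simp) (by simpa using hx) hd.forPop_cur).mono ?_
  omega

theorem cons {a : α} (h' : Consumes k p w r₁ s₁ r₂ s₂ d)
    (h : ∀ v, ∃ x, Runs p { r with cur := some a } (Function.update s k v) { r₁ with cur := x }
      (Function.update s₁ k v) c) :
    Consumes k p (a :: w) r s r₂ s₂ (c + 1 + d) :=
  (single h).append h'

theorem runs (h : Consumes k p w r s r₁ s₁ c) :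
    Runs (forPop k p) r (Function.update s k w) { r₁ with cur := none } (Function.update s₁ k [])
      (c + 1) := by
  simpa using h [] { r₁ with cur := none } _ 1 (.forPop_nil (by simp))

theorem ofFn_flatten {n : ℕ} {w : Fin n → List α} (R : ℕ → Reg α) (S : ℕ → K → List α)
    (h : ∀ j : Fin n, Consumes k p (w j) (R j) (S j) (R (j + 1)) (S (j + 1)) c) :
    Consumes k p (List.ofFn w).flatten (R 0) (S 0) (R n) (S n) (n * c) := by
  induction n with
  | zero => simpa using nil
  | succ n ih =>
    rw [List.ofFn_succ', List.concat_eq_append, List.flatten_append, List.flatten_singleton,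
      Nat.succ_mul]
    exact (ih fun j => h j.castSucc).append (h (Fin.last n))

theorem ofFn {n : ℕ} {w : Fin n → α} (R : ℕ → Reg α) (S : ℕ → K → List α)
    (h : ∀ (j : Fin n) v, ∃ x, Runs p { R j with cur := some (w j) } (Function.update (S j) k v)
      { R (j + 1) with cur := x } (Function.update (S (j + 1)) k v) c) :
    Consumes k p (List.ofFn w) (R 0) (S 0) (R n) (S n) (n * (c + 1)) := by
  have hw : (List.ofFn fun j => [w j]).flatten = List.ofFn w := by
    rw [← List.flatMap_singleton' (List.ofFn w), List.flatMap_def, List.map_ofFn,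
      Function.comp_def]
  exact hw ▸ ofFn_flatten R S fun j => single (h j)

end Consumes

namespace Runs

variable {r : Reg α} {s : K → List α}

theorem clear :
    Runs (clear k) r s { r with cur := none } (Function.update s k []) ((s k).length + 1) := by
  have key (w : List α) : Consumes k Prog.skip w r s r s w.length := by
    induction w with
    | nil => exact .nil
    | cons a w ih => exact (ih.cons (c := 0) fun v => ⟨_, skip⟩).mono (by simp [add_comm])
  simpa [Prog.clear] using (key (s k)).runs

theorem pushWord (w : List α) :
    Runs (pushWord k w) r s r (Function.update s k (w.reverse ++ s k)) 0 := by
  induction w generalizing s with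
  | nil => simpa [Prog.pushWord, Prog.forList] using skip
  | cons a w ih =>
    simpa [Prog.pushWord, Prog.forList, pushLetter] using
      (push (r := r) (s := s) k fun _ => a).seq ih

theorem forList {ι : Type} {f : ι → Prog α K} {R : List ι → Reg α} {S : List ι → K → List α}
    {c : ℕ} (l : List ι)
    (h : ∀ l₁ a l₂, l = l₁ ++ a :: l₂ →
      Runs (f a) (R l₁) (S l₁) (R (l₁ ++ [a])) (S (l₁ ++ [a])) c) :
    Runs (forList l f) (R []) (S []) (R l) (S l) (l.length * c) := by
  suffices ∀ l₁ l₂, l = l₁ ++ l₂ →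
      Runs (Prog.forList l₂ f) (R l₁) (S l₁) (R l) (S l) (l₂.length * c) from this [] l rfl
  intro l₁ l₂ hl
  induction l₂ generalizing l₁ with
  | nil =>
    rw [List.append_nil] at hl
    subst hl
    exact skip.mono (Nat.zero_le _)
  | cons a l₂ ih =>
    refine ((h l₁ a l₂ hl).seq (ih (l₁ ++ [a]) (by simpa using hl))).mono ?_
    simp [Nat.succ_mul, add_comm]

variable [Inhabited α]

theorem pushCur {a : α} (h : r.cur = some a) :
    Runs (pushCur k) r s r (Function.update s k (a :: s k)) 0 := by
  simpa only [Prog.pushCur, h, Option.getD_some] using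
    push (r := r) (s := s) k fun r => r.cur.getD default

theorem move {j : K} (h : k ≠ j) :
    Runs (move k j) r s { r with cur := none }
      (Function.update (Function.update s j ((s k).reverse ++ s j)) k []) ((s k).length + 1) := by
  have key (w : List α) (s : K → List α) : Consumes k (Prog.pushCur j) w r s r
      (Function.update s j (w.reverse ++ s j)) w.length := by
    induction w generalizing s with
    | nil => simpa using Consumes.nil
    | cons a w ih =>
      refine ((ih (Function.update s j (a :: s j))).cons (c := 0) fun v => ⟨some a, ?_⟩).of_eq
        rfl (by simp) (by simp [add_comm])
      have hpush := pushCur (r := { r with cur := some a }) (s := Function.update s k v)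
        (k := j) rfl
      rwa [Function.update_of_ne h.symm, Function.update_comm h] at hpush
  simpa [Prog.move] using (key (s k) s).runs

end Runs

section Subroutine

variable {T : TM2ComputableAux α α} [Inhabited α]

theorem Exec.forPop_give (r : Reg α) (s : K → List α) (S : ∀ j, List (T.tm.Γ j)) :
    Exec T (forPop k (.give fun r => r.cur.getD default)) ⟨r, s, S⟩
      ⟨{ r with cur := none }, Function.update s k [],
        Function.update S T.tm.k₀ ((s k).reverse.map T.inputAlphabet.symm ++ S T.tm.k₀)⟩
      ((s k).length + 1) := by
  generalize hu : s k = u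
  induction u generalizing r s S with
  | nil =>
    have hs : Function.update s k [] = s := by rw [← hu, Function.update_eq_self]
    simpa [hs] using Exec.forPop_nil (m := ⟨r, s, S⟩) hu
  | cons a u ih =>
    simpa [add_comm] using Exec.forPop_cons (m := ⟨r, s, S⟩) hu
      (.give (fun r => r.cur.getD default) _)
      (ih { r with cur := some a } (Function.update s k u)
        (Function.update S T.tm.k₀ (T.inputAlphabet.symm a :: S T.tm.k₀)) (by simp))

theorem Exec.forTake_pushCur (y : List α) (r : Reg α) (s : K → List α)
    (S : ∀ j, List (T.tm.Γ j)) :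
    Exec T (forTake (pushCur k))
      ⟨r, s, Function.update S T.tm.k₁ (y.map T.outputAlphabet.symm)⟩
      ⟨{ r with cur := none }, Function.update s k (y.reverse ++ s k),
        Function.update S T.tm.k₁ []⟩ (y.length + 1) := by
  induction y generalizing r s with
  | nil =>
    simpa [forTake] using (Exec.take ⟨r, s, Function.update S T.tm.k₁ []⟩).seq
      (.loop_exit (p := pushCur k ;; .take) (b := fun r => r.cur.isSome) (by simp))
  | cons a y ih =>
    have hrest := ih { r with cur := some a } (Function.update s k (a :: s k))
    generalize hn : y.length + 1 = n at hrest
    cases hrest with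
    | @seq _ _ _ m' _ c d h₁ h₂ =>
      have htake := Exec.take (T := T)
        ⟨r, s, Function.update S T.tm.k₁ ((a :: y).map T.outputAlphabet.symm)⟩
      simp only [List.map_cons, Function.update_self, List.head?_cons, Option.map_some,
        Equiv.apply_symm_apply, List.tail_cons, Function.update_idem] at htake
      have h := htake.seq (.loop_step (p := pushCur k ;; .take) (b := fun r => r.cur.isSome) rfl
        (.seq (.push _ _ _) h₁) h₂)
      rw [show (a :: y).length + 1 = 0 + (1 + (0 + c + d)) by rw [List.length_cons]; omega]
      simpa [forTake] using h

theorem Exec.invoke {i o : K} (hio : i ≠ o) {w y : List α} {t : ℕ}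
    (h : TM2OutputsInTime T.tm (w.map T.inputAlphabet.symm)
      (some (y.map T.outputAlphabet.symm)) t) (r : Reg α) (s : K → List α) (hi : s i = w.reverse)
    (ho : s o = []) :
    ∃ n ≤ w.length + t + 2 * y.length + 3,
      Exec T (invoke i o) ⟨r, s, fun _ => []⟩
        ⟨{ r with cur := none }, Function.update (Function.update s o y) i [], fun _ => []⟩ n := by
  obtain ⟨⟨n, hn⟩, hnt : n ≤ t⟩ := h
  rw [initList_eq, Option.map_some, haltList_eq] at hn
  have hgive := Exec.forPop_give (T := T) (k := i) r s fun _ => []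
  rw [hi, List.reverse_reverse, List.append_nil] at hgive
  have hcall := Exec.call n ⟨{ r with cur := none }, Function.update s i [], _⟩ _ hn
  have htake := Exec.forTake_pushCur (k := i) y { r with cur := none } (Function.update s i [])
    fun j : T.tm.K => []
  rw [show Function.update (fun j : T.tm.K => ([] : List (T.tm.Γ j))) T.tm.k₁ [] = fun _ => [] from
    Function.update_eq_self_iff.2 rfl] at htake
  simp only [Function.update_self, Function.update_idem, List.append_nil] at htake
  obtain ⟨m, hm, hmove⟩ := Runs.move hio (r := { r with cur := none })
    (s := Function.update s i y.reverse) T fun _ => []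
  simp only [Function.update_self, Function.update_of_ne hio.symm, ho, List.reverse_reverse,
    List.append_nil, Function.update_comm hio, Function.update_idem] at hmove
  refine ⟨_, ?_, hgive.seq (hcall.seq (htake.seq hmove))⟩
  simp only [Function.update_self, List.length_reverse] at hm ⊢
  omega

end Subroutine

end ProgramLogic

section OutputLength

theorem exists_length_stepAux_le {K : Type} [DecidableEq K] {Γ : K → Type} {Λ σ : Type}
    (q : TM2.Stmt Γ Λ σ) :
    ∃ C, ∀ v S k, ((TM2.stepAux q v S).stk k).length ≤ (S k).length + C := by
  induction q with
  | push j f q ih =>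
    obtain ⟨C, hC⟩ := ih
    refine ⟨C + 1, fun v S k => (hC v _ k).trans ?_⟩
    rcases eq_or_ne k j with rfl | h
    · rw [Function.update_self, List.length_cons, add_assoc, add_comm 1]
    · rw [Function.update_of_ne h]
      omega
  | peek j f q ih =>
    obtain ⟨C, hC⟩ := ih
    exact ⟨C, fun v S k => hC _ S k⟩
  | pop j f q ih =>
    obtain ⟨C, hC⟩ := ih
    refine ⟨C, fun v S k => (hC _ _ k).trans ?_⟩
    rcases eq_or_ne k j with rfl | h
    · simp
    · rw [Function.update_of_ne h]
  | load f q ih =>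
    obtain ⟨C, hC⟩ := ih
    exact ⟨C, fun v S k => hC _ S k⟩
  | branch f q₁ q₂ ih₁ ih₂ =>
    obtain ⟨C₁, h₁⟩ := ih₁
    obtain ⟨C₂, h₂⟩ := ih₂
    refine ⟨C₁ + C₂, fun v S k => ?_⟩
    have hb₁ := h₁ v S k
    have hb₂ := h₂ v S k
    rw [TM2.stepAux]
    cases f v <;> simp only [cond_true, cond_false] <;> omega
  | goto f => exact ⟨0, fun v S k => le_rfl⟩
  | halt => exact ⟨0, fun v S k => le_rfl⟩

theorem StepsTo.exists_length_le {K : Type} [DecidableEq K] {Γ : K → Type} {Λ σ : Type} [Finite Λ]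
    (M : Λ → TM2.Stmt Γ Λ σ) :
    ∃ C, ∀ n c c', StepsTo M n c c' → ∀ k, (c'.stk k).length ≤ (c.stk k).length + n * C := by
  have := Fintype.ofFinite Λ
  choose C hC using fun l => exists_length_stepAux_le (M l)
  refine ⟨∑ l, C l, fun n c => ?_⟩
  induction n with
  | zero =>
    intro c' h k
    simp [StepsTo.zero_iff.1 h]
  | succ n ih =>
    intro c' h k
    obtain ⟨⟨_ | l, v, S⟩, hd, hstep⟩ := StepsTo.succ_iff.1 h
    · cases hstep
    · have hsum : C l ≤ ∑ l, C l :=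
        Finset.single_le_sum (fun _ _ => Nat.zero_le _) (Finset.mem_univ l)
      have hstk := ih _ hd k
      have hlast := hC l v S k
      rw [← Option.some.inj hstep, Nat.succ_mul]
      dsimp only at hstk
      exact hlast.trans (by omega)

theorem exists_length_output_le {α : Type} (T : TM2ComputableAux α α) :
    ∃ C, ∀ (w y : List α) (t : ℕ), Nonempty (TM2OutputsInTime T.tm
      (w.map T.inputAlphabet.symm) (some (y.map T.outputAlphabet.symm)) t) →
      y.length ≤ w.length + t * C := by
  have := T.tm.ΛFin
  obtain ⟨C, hC⟩ := StepsTo.exists_length_le T.tm.m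
  refine ⟨C, ?_⟩
  rintro w y t ⟨⟨⟨n, hn⟩, hnt⟩⟩
  rw [initList_eq, Option.map_some, haltList_eq] at hn
  have hlen := hC n _ _ hn T.tm.k₁
  simp only [Function.update_self, List.length_map] at hlen
  refine hlen.trans (add_le_add ?_ (Nat.mul_le_mul_right _ hnt))
  have hstk (k) (v : List (T.tm.Γ T.tm.k₀)) :
      (Function.update (fun _ => []) T.tm.k₀ v k : List (T.tm.Γ k)).length ≤ v.length := by
    rcases eq_or_ne k T.tm.k₀ with rfl | h
    · rw [Function.update_self]
    · simp [Function.update_of_ne h]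
  simpa using hstk T.tm.k₁ (w.map T.inputAlphabet.symm)

end OutputLength

open Prog

/-! ### The work stacks of the reduction -/

/-- The work stacks of the reduction. The input and the output are on `inp` and `out`, the marked
adjacency matrix on `graph`, the number of vertices in unary on `count`, the row that is being
processed on `row`, the bits that belong to the diagonal on `diag`, the instance of the matrix
problem and its solution on `word`, and the sets of selected vertices on `sel`; the primed stacks
are for intermediate results. -/
inductive Stack
  | inp | graph | graph' | count | count' | row | row' | diag | diag' | word | word' | sel | sel'
  | out
  deriving DecidableEq

instance : Fintype Stack :=
  ⟨{.inp, .graph, .graph', .count, .count', .row, .row', .diag, .diag', .word, .word', .sel, .sel',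
    .out}, fun k => by cases k <;> decide⟩

instance : Inhabited Letter := ⟨.bot⟩

/-- The contents of the work stacks. -/
structure Store where
  (inp graph graph' count count' row row' diag diag' word word' sel sel' out : List Letter := [])

namespace Store

/-- The content of a stack. -/
@[simp]
def get (s : Store) : Stack → List Letter
  | .inp => s.inp | .graph => s.graph | .graph' => s.graph' | .count => s.count
  | .count' => s.count' | .row => s.row | .row' => s.row' | .diag => s.diag | .diag' => s.diag'
  | .word => s.word | .word' => s.word' | .sel => s.sel | .sel' => s.sel' | .out => s.out

/-- Replace the content of a stack. -/
@[simp]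
def set (s : Store) (k : Stack) (w : List Letter) : Store :=
  match k with
  | .inp => { s with inp := w } | .graph => { s with graph := w }
  | .graph' => { s with graph' := w } | .count => { s with count := w }
  | .count' => { s with count' := w } | .row => { s with row := w }
  | .row' => { s with row' := w } | .diag => { s with diag := w }
  | .diag' => { s with diag' := w } | .word => { s with word := w }
  | .word' => { s with word' := w } | .sel => { s with sel := w }
  | .sel' => { s with sel' := w } | .out => { s with out := w }

@[simp]
theorem update_get (s : Store) (k : Stack) (w : List Letter) :
    Function.update s.get k w = (s.set k w).get := by
  funext j
  cases k <;> cases j <;> rfl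

theorem get_injective : Function.Injective get := by
  rintro ⟨⟩ ⟨⟩ h
  simp only [mk.injEq]
  exact ⟨congrFun h .inp, congrFun h .graph, congrFun h .graph', congrFun h .count,
    congrFun h .count', congrFun h .row, congrFun h .row', congrFun h .diag, congrFun h .diag',
    congrFun h .word, congrFun h .word', congrFun h .sel, congrFun h .sel', congrFun h .out⟩

@[simp]
theorem get_inj {s s' : Store} : s.get = s'.get ↔ s = s' := get_injective.eq_iff

end Store

theorem take_ofFn_succ {α : Type*} {n : ℕ} (f : Fin n → α) (j : Fin n) :
    (List.ofFn f).take (j + 1) = (List.ofFn f).take j ++ [f j] := by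
  rw [List.take_add_one, List.getElem?_ofFn, dif_pos j.2, Option.toList_some]

theorem take_ofFn_self {α : Type*} {n : ℕ} (f : Fin n → α) : (List.ofFn f).take n = List.ofFn f :=
  List.take_of_length_le (by simp)

/-! ### Marking the diagonal of the adjacency matrix -/

/-- The letter for an entry of the adjacency matrix, with the diagonal marked by `⊥`. -/
def markedEntry {n : ℕ} (adj : Fin n → Fin n → Bool) (i j : Fin n) : Letter :=
  if i = j then .bot else .bit (adj i j)

/-- A row of the marked adjacency matrix. -/
def markedRow {n : ℕ} (adj : Fin n → Fin n → Bool) (i : Fin n) : List Letter :=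
  List.ofFn (markedEntry adj i) ++ [.newline]

/-- The marked adjacency matrix. -/
def markedWord {n : ℕ} (adj : Fin n → Fin n → Bool) : List Letter :=
  (List.ofFn (markedRow adj)).flatten

/-- A number in unary. -/
def unary (n : ℕ) : List Letter := List.replicate n .comma

@[simp] theorem unary_zero : unary 0 = [] := rfl

theorem unary_succ (n : ℕ) : unary (n + 1) = .comma :: unary n := rfl

@[simp] theorem length_unary (n : ℕ) : (unary n).length = n := List.length_replicate

@[simp] theorem reverse_unary (n : ℕ) : (unary n).reverse = unary n := List.reverse_replicate

namespace Prog

/-- Copy a letter of the adjacency matrix to the stack `graph`, without commas and with the diagonal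
marked; the stack `count` holds the number of rows read so far. -/
def markLetter : Prog Letter Stack :=
  .ite (isCur .newline)
    (pushCur .graph ;; move .count' .count ;; pushLetter .count .comma ;;
      .load fun r => { r with flag := false })
    (.ite (isCur .comma) skip
      (pushCur .graph ;; .ite (fun r => r.flag) skip
        (.pop .count ;; .ite (fun r => r.cur.isNone)
          (.pop .graph ;; pushLetter .graph .bot ;; .load fun r => { r with flag := true })
          (pushCur .count'))))

/-- Read the adjacency matrix. -/
def mark : Prog Letter Stack := forPop .inp markLetter

end Prog

theorem length_markedWord {n : ℕ} (adj : Fin n → Fin n → Bool) :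
    (markedWord adj).length = n * (n + 1) := by
  simp [markedWord, markedRow, List.length_flatten, List.map_ofFn, Function.comp_def]

theorem consumes_markLetter_entry {n : ℕ} (adj : Fin n → Fin n → Bool) (i j : Fin n) (s : Store)
    (g : List Letter) :
    Consumes .inp markLetter ([.bit (adj i j)] ++ [.comma]) ⟨none, decide ((i : ℕ) < j), false⟩
      { s with
        graph := ((List.ofFn (markedEntry adj i)).take j).reverse ++ g
        count := unary (i - j), count' := unary (min i j) }.get
      ⟨none, decide ((i : ℕ) < j + 1), false⟩
      { s with
        graph := ((List.ofFn (markedEntry adj i)).take (j + 1)).reverse ++ g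
        count := unary (i - (j + 1)), count' := unary (min i (j + 1)) }.get 2 := by
  refine .append (c := 1) (d := 1) (.single (c := 0) fun v => ?_)
    (.single (c := 0) fun v => ⟨_, .ite_false rfl (.ite_true rfl .skip)⟩)
  rw [take_ofFn_succ, List.reverse_append, List.reverse_singleton, List.singleton_append,
    List.cons_append]
  rcases lt_trichotomy (i : ℕ) j with h | h | h
  · refine ⟨_, .of_eq (.ite_false rfl (.ite_false rfl (.seq (.pushCur rfl)
      (.ite_true (by simp [h]) .skip)))) (by simp [h, h.trans (Nat.lt_succ_self _)]; rfl) ?_ le_rfl⟩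
    have hentry : markedEntry adj i j = .bit (adj i j) := if_neg (by rintro rfl; omega)
    simp only [Store.update_get, Store.get_inj, Store.set, Store.get, hentry, Store.mk.injEq,
      true_and, and_true]
    exact ⟨congrArg _ (by omega), congrArg _ (by omega)⟩
  · obtain rfl : i = j := Fin.ext h
    refine ⟨_, .of_eq (.ite_false rfl (.ite_false rfl (.seq (.pushCur rfl)
      (.ite_false (by simp) (.seq (.pop _) (.ite_true (by simp)
      (.seq (.pop _) (.seq (.push _ _) (.load _))))))))) (by simp; rfl) ?_ le_rfl⟩
    have hentry : markedEntry adj i i = .bot := if_pos rfl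
    simp only [Store.update_get, Store.get_inj, Store.set, Store.get, hentry, Store.mk.injEq,
      true_and, and_true]
    simp
  · obtain ⟨m, hm⟩ : ∃ m, (i : ℕ) - j = m + 1 := ⟨i - j - 1, by omega⟩
    rw [hm, show (i : ℕ) - (j + 1) = m by omega, show min (i : ℕ) (j + 1) = j + 1 by omega,
      show min (i : ℕ) j = j by omega]
    refine ⟨some .comma, .of_eq (.ite_false rfl (.ite_false rfl (.seq (.pushCur rfl)
      (.ite_false (by simpa using h.le) (.seq (.pop _)
      (.ite_false (by simp [unary_succ])
      (.pushCur (a := .comma) (by simp [unary_succ]))))))))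
      (by simp [show ¬ (i : ℕ) < j by omega, show ¬ (i : ℕ) < j + 1 by omega, -Fin.val_fin_lt,
        -not_lt, Store.get, Store.set, unary_succ]) ?_ le_rfl⟩
    have hentry : markedEntry adj i j = .bit (adj i j) := if_neg (by rintro rfl; omega)
    simp only [Store.update_get, Store.get_inj, Store.set, Store.get, hentry, Store.mk.injEq,
      true_and, and_true]
    simp [unary_succ]

theorem consumes_markLetter_row {n : ℕ} (adj : Fin n → Fin n → Bool) (i : Fin n) (s : Store)
    (g : List Letter) :
    Consumes .inp markLetter
      ((List.ofFn fun j => [.bit (adj i j)] ++ [.comma]).flatten ++ [.newline])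
      .init { s with graph := g, count := unary i, count' := [] }.get
      .init
      { s with graph := (markedRow adj i).reverse ++ g, count := unary (i + 1), count' := [] }.get
      (3 * n + 2) := by
  have h1 := Consumes.ofFn_flatten (fun j => ⟨none, decide ((i : ℕ) < j), false⟩)
    (fun j => { s with
      graph := ((List.ofFn (markedEntry adj i)).take j).reverse ++ g
      count := unary (i - j), count' := unary (min i j) }.get)
    fun j => consumes_markLetter_entry adj i j s g
  simp only [Nat.not_lt_zero, decide_false, List.take_zero, List.reverse_nil, List.nil_append,
    Nat.sub_zero, Nat.min_zero, unary_zero, i.2, decide_true] at h1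
  refine (h1.append (Consumes.single (r₁ := .init) (c := n + 1)
    fun v => ⟨_, .of_eq (.ite_true rfl (.seq (.pushCur rfl) (.seq (.move (by decide))
      (.seq (.push _ _) (.load _))))) rfl ?_ ?_⟩)).mono (by omega)
  · simp [markedRow, unary_succ, i.2.le]
  · simp

theorem runs_mark {n : ℕ} (adj : Fin n → Fin n → Bool) :
    Runs mark .init
      { inp := encodeMatrix (fun b : Bool => [Letter.bit b]) adj : Store }.get
      .init
      { graph := (markedWord adj).reverse, count := unary n : Store }.get
      (n * (3 * n + 2) + 1) := by
  have h := Consumes.ofFn_flatten (k := .inp) (p := markLetter) (c := 3 * n + 2)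
    (w := fun i : Fin n => (List.ofFn fun j => [.bit (adj i j)] ++ [.comma]).flatten ++ [.newline])
    (fun _ => .init)
    (fun i => { graph := ((List.ofFn (markedRow adj)).take i).flatten.reverse,
                count := unary i : Store }.get) fun i => ?_
  · simpa [mark, markedWord, take_ofFn_self, encodeMatrix] using h.runs
  · rw [take_ofFn_succ, List.flatten_append, List.flatten_singleton, List.reverse_append]
    exact consumes_markLetter_row adj i {} _

/-! ### Writing the instance of the matrix problem -/

namespace Prog

/-- Write the word that belongs to the letter read last. -/
def emitEntry (E : Letter → List Letter) : Prog Letter Stack :=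
  .ite (isCur .bot) (pushWord .word (E .bot))
    (.ite (isCur (.bit true)) (pushWord .word (E (.bit true))) (pushWord .word (E (.bit false))))

/-- Write the words that belong to the letters of the stack `row`. -/
def emitRow (E : Letter → List Letter) : Prog Letter Stack :=
  move .row .row' ;; forPop .row' (pushCur .row ;; emitEntry E)

/-- Collect a row of the marked adjacency matrix, and at its end write the words that belong to
it. -/
def emitLetter {ι : Type} (l : List ι) (E : ι → Letter → List Letter) : Prog Letter Stack :=
  pushCur .graph ;; .ite (isCur .newline)
    (forList l (fun b => emitRow (E b)) ;; pushLetter .word .newline ;; clear .row)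
    (pushCur .row)

/-- Write a block matrix whose blocks are images of the marked adjacency matrix. -/
def emit {ι : Type} (l : List ι) (E : ι → ι → Letter → List Letter) : Prog Letter Stack :=
  forList l fun a => move .graph .graph' ;; forPop .graph' (emitLetter l (E a))

end Prog

/-- The image of a row under a substitution. -/
def rowImage {n : ℕ} (E : Letter → List Letter) (x : Fin n → Letter) : List Letter :=
  (List.ofFn fun j => E (x j)).flatten

/-- A row of the block matrix. -/
def blockRow {ι : Type} {n : ℕ} (l : List ι) (E : ι → Letter → List Letter) (x : Fin n → Letter) :
    List Letter :=
  (l.map fun b => rowImage (E b) x).flatten ++ [.newline]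

/-- A row of blocks, which consists of `n` rows of the block matrix. -/
def blockBand {ι : Type} {n : ℕ} (l : List ι) (E : ι → Letter → List Letter)
    (x : Fin n → Fin n → Letter) : List Letter :=
  (List.ofFn fun i => blockRow l E (x i)).flatten

/-- The block matrix whose blocks are the images of the matrix `x` under the substitutions `E`. -/
def blockMatrix {ι : Type} {n : ℕ} (l : List ι) (E : ι → ι → Letter → List Letter)
    (x : Fin n → Fin n → Letter) : List Letter :=
  (l.map fun a => blockBand l (E a) x).flatten

section Emit

variable {n : ℕ} (adj : Fin n → Fin n → Bool)

theorem isCur_newline_markedEntry (i j : Fin n) (f g : Bool) :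
    isCur .newline ⟨some (markedEntry adj i j), f, g⟩ = false := by
  unfold markedEntry
  split_ifs <;> rfl

theorem runs_emitEntry (E : Letter → List Letter) (i j : Fin n) (r : Reg Letter)
    (s : Stack → List Letter) (hr : r.cur = some (markedEntry adj i j)) :
    Runs (emitEntry E) r s r
      (Function.update s .word ((E (markedEntry adj i j)).reverse ++ s .word)) 0 := by
  unfold markedEntry at hr ⊢
  split_ifs at hr ⊢ with h
  · exact .ite_true (by simp [isCur, hr]) (.pushWord _)
  · refine .ite_false (by simp [isCur, hr]) ?_
    cases hb : adj i j
    · exact .ite_false (by simp [isCur, hr, hb]) (.pushWord _)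
    · exact .ite_true (by simp [isCur, hr, hb]) (.pushWord _)

theorem runs_emitRow (E : Letter → List Letter) (i : Fin n) (r : Reg Letter) (s : Store) :
    Runs (emitRow E) r
      { s with row := (List.ofFn (markedEntry adj i)).reverse, row' := [] }.get
      { r with cur := none }
      { s with
        row := (List.ofFn (markedEntry adj i)).reverse, row' := []
        word := (rowImage E (markedEntry adj i)).reverse ++ s.word }.get (2 * n + 2) := by
  have h := Consumes.ofFn (k := .row') (p := pushCur .row ;; emitEntry E) (c := 0)
    (w := markedEntry adj i) (fun _ => r)
    (fun j => { s with
      row := ((List.ofFn (markedEntry adj i)).take j).reverse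
      word := ((List.ofFn fun j => E (markedEntry adj i j)).take j).flatten.reverse
        ++ s.word }.get)
    fun j v => ⟨_, .of_eq (.seq (.pushCur rfl) (runs_emitEntry adj E i j _ _ rfl)) rfl ?_ le_rfl⟩
  · rw [take_ofFn_self, take_ofFn_self] at h
    refine (Runs.seq_of_eq (.move (by decide)) h.runs.forPop_cur rfl ?_).of_eq rfl ?_ ?_
    · simp
    · simp [rowImage]
    · simp
      omega
  · rw [take_ofFn_succ, take_ofFn_succ]
    simp

variable {ι : Type} (l : List ι) (E : ι → Letter → List Letter)

theorem runs_emitLetter_newline (i : Fin n) (g v : List Letter) (s : Store) :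
    Runs (emitLetter l E) ⟨some .newline, false, false⟩
      { s with
        graph := g, graph' := v, row := (List.ofFn (markedEntry adj i)).reverse, row' := [] }.get
      .init
      { s with
        graph := .newline :: g, graph' := v, row := [], row' := []
        word := (blockRow l E (markedEntry adj i)).reverse ++ s.word }.get
      (l.length * (2 * n + 2) + (n + 1)) := by
  refine .of_eq (.seq_of_eq (.pushCur rfl) (.ite_true rfl (.seq (.forList (c := 2 * n + 2)
    (R := fun m => ⟨if m = [] then some .newline else none, false, false⟩)
    (S := fun m => { s with
      graph := .newline :: g, graph' := v
      row := (List.ofFn (markedEntry adj i)).reverse, row' := []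
      word := ((m.map fun b => rowImage (E b) (markedEntry adj i)).flatten).reverse
        ++ s.word }.get) l fun l₁ b l₂ _ => ?_)
    (.seq (.push _ _) .clear))) rfl (by simp)) rfl ?_ ?_
  · simpa using runs_emitRow adj (E b) i ⟨if l₁ = [] then some .newline else none, false, false⟩
      { s with
        graph := .newline :: g, graph' := v
        word := ((l₁.map fun b => rowImage (E b) (markedEntry adj i)).flatten).reverse ++ s.word }
  · simp [blockRow]
  · simp

theorem consumes_emitLetter_row (i : Fin n) (s : Store) :
    Consumes .graph' (emitLetter l E) (markedRow adj i)
      .init { s with row := [], row' := [] }.get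
      .init { s with
        graph := (markedRow adj i).reverse ++ s.graph, row := [], row' := []
        word := (blockRow l E (markedEntry adj i)).reverse ++ s.word }.get
      (2 * n + 2 + l.length * (2 * n + 2)) := by
  have hentries := Consumes.ofFn (k := .graph') (p := emitLetter l E) (c := 0)
    (w := markedEntry adj i) (fun _ => .init)
    (fun j => { s with
      graph := ((List.ofFn (markedEntry adj i)).take j).reverse ++ s.graph
      row := ((List.ofFn (markedEntry adj i)).take j).reverse, row' := [] }.get)
    fun j v => ⟨_, .of_eq (.seq (.pushCur rfl)
      (.ite_false (isCur_newline_markedEntry adj i j _ _) (.pushCur rfl))) rfl ?_ le_rfl⟩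
  · rw [take_ofFn_self] at hentries
    refine (hentries.append (.single (c := l.length * (2 * n + 2) + (n + 1))
      fun v => ⟨none, ?_⟩)).mono (by omega)
    simpa [markedRow] using runs_emitLetter_newline adj l E i
      ((List.ofFn (markedEntry adj i)).reverse ++ s.graph) v s
  · rw [take_ofFn_succ]
    simp

theorem runs_emit_block (w : List Letter) :
    Runs (move .graph .graph' ;; forPop .graph' (emitLetter l E))
      .init { graph := (markedWord adj).reverse, count := unary n, word := w : Store }.get
      .init { graph := (markedWord adj).reverse, count := unary n,
              word := (blockBand l E (markedEntry adj)).reverse ++ w : Store }.get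
      (n * (n + 1) + 1 + (n * (2 * n + 2 + l.length * (2 * n + 2)) + 1)) := by
  have h := Consumes.ofFn_flatten (k := .graph') (p := emitLetter l E) (w := markedRow adj)
    (c := 2 * n + 2 + l.length * (2 * n + 2)) (fun _ => .init)
    (fun i => { graph := ((List.ofFn (markedRow adj)).take i).flatten.reverse, count := unary n,
                word := ((List.ofFn fun i =>
                  blockRow l E (markedEntry adj i)).take i).flatten.reverse ++ w : Store }.get)
    fun i => ?_
  · rw [take_ofFn_self, take_ofFn_self] at h
    refine .of_eq (.seq_of_eq (.move (by decide)) h.runs rfl ?_) rfl ?_ ?_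
    · simp [markedWord]
    · simp [markedWord, blockBand]
    · simp [length_markedWord]
  · rw [take_ofFn_succ, take_ofFn_succ]
    simpa using consumes_emitLetter_row adj l E i
      { graph := ((List.ofFn (markedRow adj)).take i).flatten.reverse, count := unary n,
        word := ((List.ofFn fun i =>
          blockRow l E (markedEntry adj i)).take i).flatten.reverse ++ w }

theorem runs_emit (E : ι → ι → Letter → List Letter) :
    Runs (emit l E)
      .init { graph := (markedWord adj).reverse, count := unary n : Store }.get
      .init { graph := (markedWord adj).reverse, count := unary n,
              word := (blockMatrix l E (markedEntry adj)).reverse : Store }.get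
      (l.length * (n * (n + 1) + 1 + (n * (2 * n + 2 + l.length * (2 * n + 2)) + 1))) :=
  .forList (R := fun _ => .init)
    (S := fun m =>
      { graph := (markedWord adj).reverse, count := unary n,
        word := (m.map fun a => blockBand l (E a) (markedEntry adj)).flatten.reverse : Store }.get)
    l fun l₁ a l₂ _ => (runs_emit_block adj l (E a) _).of_eq rfl (by simp) le_rfl

end Emit

/-! ### Rounding a rational matrix to bits -/

/-- A test that is passed by the rational numbers `q ≥ 2⁻ᵉ`, and failed by those with
`2 q ≤ 2⁻ᵉ`. It only compares the lengths of the numerator and the denominator, so that it is easy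
to carry out on words. -/
def isLarge (e : ℕ) (q : ℚ) : Bool := decide (0 < q ∧ q.den.size ≤ q.num.natAbs.size + e)

/-- A word of bits. -/
def bitWord {n : ℕ} (p : Fin n → Bool) : List Letter := List.ofFn fun j => .bit (p j)

namespace Prog

/-- Read a letter of a matrix of rational numbers, and write the result of `isLarge` at the end of
each number. The stack `row` holds the length of the numerator, `flag` says that the test has
failed, and `aux` says that the denominator is being read. -/
def roundLetter (e : ℕ) : Prog Letter Stack :=
  .ite (isCur .newline) skip
  (.ite (isCur .comma)
    (.push .word (fun r => .bit !r.flag) ;; clear .row ;; .load fun _ => .init)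
  (.ite (isCur .minus) (.load fun r => { r with flag := true })
  (.ite (isCur .slash)
    (.pop .row ;;
      .ite (fun r => r.cur.isNone) (.load fun r => { r with flag := true }) (pushCur .row) ;;
      pushWord .row (unary e) ;; .load fun r => { r with aux := true })
  (.ite (fun r => r.aux)
    (.pop .row ;; .ite (fun r => r.cur.isNone) (.load fun r => { r with flag := true }) skip)
    (pushCur .row)))))

/-- Round a matrix of rational numbers. -/
def round (e : ℕ) : Prog Letter Stack := forPop .word' (roundLetter e)

end Prog

theorem consumes_roundLetter_num (e : ℕ) (f : Bool) (u : List Bool) (s : Store) :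
    Consumes .word' (roundLetter e) (u.map Letter.bit) ⟨none, f, false⟩ s.get ⟨none, f, false⟩
      { s with row := (u.map Letter.bit).reverse ++ s.row }.get u.length := by
  induction u generalizing s with
  | nil => exact .nil
  | cons b u ih =>
    refine ((ih { s with row := .bit b :: s.row }).cons (c := 0) fun v => ⟨some (.bit b), .of_eq
      (.ite_false rfl (.ite_false rfl (.ite_false rfl (.ite_false rfl (.ite_false rfl
        (.pushCur rfl)))))) rfl (by simp) le_rfl⟩).of_eq rfl ?_ ?_
    · simp
    · simp [add_comm]

theorem consumes_roundLetter_den (e : ℕ) (f : Bool) (u : List Bool) (s : Store) :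
    Consumes .word' (roundLetter e) (u.map Letter.bit) ⟨none, f, true⟩ s.get
      ⟨none, f || decide (s.row.length < u.length), true⟩
      { s with row := s.row.drop u.length }.get u.length := by
  induction u generalizing s f with
  | nil => simpa using Consumes.nil
  | cons b u ih =>
    cases hrow : s.row with
    | nil =>
      refine ((ih true s).cons (c := 0) fun v => ⟨none, .ite_false rfl (.ite_false rfl
        (.ite_false rfl (.ite_false rfl (.ite_true rfl (.of_eq (.seq (.pop _)
          (.ite_true ?_ (.load _))) ?_ ?_ le_rfl)))))⟩).of_eq ?_ ?_ ?_
      all_goals simp [hrow, add_comm]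
    | cons a x =>
      refine ((ih f { s with row := x }).cons (c := 0) fun v => ⟨some a, .ite_false rfl
        (.ite_false rfl (.ite_false rfl (.ite_false rfl (.ite_true rfl (.of_eq (.seq (.pop _)
          (.ite_false ?_ .skip)) ?_ ?_ le_rfl)))))⟩).of_eq ?_ ?_ ?_
      all_goals simp [hrow, add_comm]

theorem consumes_roundLetter_slash (e : ℕ) (f : Bool) (s : Store) :
    Consumes .word' (roundLetter e) [.slash] ⟨none, f, false⟩ s.get
      ⟨none, f || s.row.isEmpty, true⟩ { s with row := unary e ++ s.row }.get 1 := by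
  cases hrow : s.row with
  | nil =>
    refine .single (c := 0) fun v => ⟨none, .ite_false rfl (.ite_false rfl
      (.ite_false rfl (.ite_true rfl (.of_eq (.seq (.pop _) (.seq (.ite_true ?_ (.load _))
      (.seq (.pushWord _) (.load _)))) ?_ ?_ le_rfl))))⟩
    all_goals simp [hrow]
  | cons a x =>
    refine .single (c := 0) fun v => ⟨some a, .ite_false rfl (.ite_false rfl
      (.ite_false rfl (.ite_true rfl (.of_eq (.seq (.pop _) (.seq (.ite_false ?_
      (.pushCur (a := a) ?_)) (.seq (.pushWord _) (.load _)))) ?_ ?_ le_rfl))))⟩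
    all_goals simp [hrow]

theorem consumes_roundLetter_comma (e : ℕ) (f : Bool) (s : Store) :
    Consumes .word' (roundLetter e) [.comma] ⟨none, f, true⟩ s.get .init
      { s with word := .bit (!f) :: s.word, row := [] }.get (s.row.length + 1 + 1) :=
  .single fun v => ⟨none, .ite_false rfl (.ite_true rfl (.of_eq (.seq (.push _ _)
    (.seq .clear (.load _))) rfl (by simp) (by simp)))⟩

theorem isLarge_eq (e : ℕ) (q : ℚ) :
    isLarge e q = !(decide (q < 0) || q.num.natAbs.bits.isEmpty ||
      decide (q.num.natAbs.bits.length + e < q.den.bits.length)) := by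
  have h0 : q.num.natAbs.bits.isEmpty = decide (q = 0) := by
    rw [Bool.eq_iff_iff, List.isEmpty_iff, decide_eq_true_eq, ← List.length_eq_zero_iff,
      Nat.size_eq_bits_len, Nat.size_eq_zero, Int.natAbs_eq_zero, Rat.num_eq_zero]
  rw [h0, isLarge, Bool.eq_iff_iff]
  simp only [Nat.size_eq_bits_len, decide_eq_true_eq, Bool.not_eq_true', Bool.or_eq_false_iff,
    decide_eq_false_iff_not, not_lt, and_congr_left_iff]
  exact fun _ => by rw [lt_iff_le_and_ne, ne_comm]

theorem consumes_roundLetter (e : ℕ) (q : ℚ) (s : Store) :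
    Consumes .word' (roundLetter e) (encodeRational q ++ [.comma])
      .init { s with row := [] }.get
      .init { s with row := [], word := .bit (isLarge e q) :: s.word }.get
      (2 * (encodeRational q ++ [Letter.comma]).length + e + 2) := by
  have hsign : Consumes .word' (roundLetter e) (if q < 0 then [Letter.minus] else []) .init
      { s with row := [] }.get ⟨none, decide (q < 0), false⟩ { s with row := [] }.get
      (if q < 0 then [Letter.minus] else []).length := by
    split_ifs with h
    · simp only [h, decide_true]
      exact .single (c := 0) fun v => ⟨_, .ite_false rfl (.ite_false rfl
        (.ite_true rfl (.load _)))⟩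
    · simpa [h] using Consumes.nil
  have hword := (((hsign.append (consumes_roundLetter_num e _ q.num.natAbs.bits _)).append
    (consumes_roundLetter_slash e _ _)).append (consumes_roundLetter_den e _ q.den.bits _)).append
    (consumes_roundLetter_comma e _ _)
  refine hword.of_eq rfl ?_ ?_
  · simp [isLarge_eq, add_comm, Bool.or_assoc]
  · simp [encodeRational, encodeNatural]
    omega

theorem take_bitWord_succ {n : ℕ} (p : Fin n → Bool) (j : Fin n) :
    (bitWord p).take (j + 1) = (bitWord p).take j ++ [.bit (p j)] :=
  take_ofFn_succ _ j

theorem take_bitWord_self {n : ℕ} (p : Fin n → Bool) : (bitWord p).take n = bitWord p :=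
  take_ofFn_self _

theorem consumes_roundLetter_row (e : ℕ) {n ℓ : ℕ} (x : Fin n → ℚ)
    (hℓ : ∀ j, (encodeRational (x j) ++ [Letter.comma]).length ≤ ℓ) (s : Store) :
    Consumes .word' (roundLetter e)
      ((List.ofFn fun j => encodeRational (x j) ++ [.comma]).flatten ++ [.newline])
      .init { s with row := [] }.get
      .init { s with
        row := [], word := (bitWord fun j => isLarge e (x j)).reverse ++ s.word }.get
      (n * (2 * ℓ + e + 2) + 1) := by
  have h := Consumes.ofFn_flatten (k := .word') (p := roundLetter e) (c := 2 * ℓ + e + 2)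
    (w := fun j => encodeRational (x j) ++ [.comma]) (fun _ => .init)
    (fun j => { s with
      row := []
      word := ((bitWord fun j => isLarge e (x j)).take j).reverse ++ s.word }.get) fun j => ?_
  · rw [take_bitWord_self] at h
    exact h.append (.single (c := 0) fun v => ⟨_, .ite_true rfl .skip⟩)
  · rw [take_bitWord_succ]
    refine (consumes_roundLetter e (x j) { s with
      word := ((bitWord fun j => isLarge e (x j)).take j).reverse ++ s.word }).of_eq rfl
      (by simp) ?_
    have := hℓ j
    omega

theorem runs_round (e : ℕ) {N ℓ : ℕ} (B : Matrix (Fin N) (Fin N) ℚ)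
    (hℓ : ∀ i j, (encodeRational (B i j) ++ [Letter.comma]).length ≤ ℓ) (g u : List Letter) :
    Runs (round e)
      .init { graph := g, count := u, word' := encodeMatrix encodeRational B : Store }.get
      .init { graph := g, count := u,
              word := (List.ofFn fun i => bitWord fun j => isLarge e (B i j)).flatten.reverse
              : Store }.get
      (N * (N * (2 * ℓ + e + 2) + 1) + 1) := by
  have h := Consumes.ofFn_flatten (k := .word') (p := roundLetter e)
    (c := N * (2 * ℓ + e + 2) + 1)
    (w := fun i => (List.ofFn fun j => encodeRational (B i j) ++ [.comma]).flatten ++ [.newline])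
    (fun _ => .init)
    (fun i => { graph := g, count := u,
                word := ((List.ofFn fun i =>
                  bitWord fun j => isLarge e (B i j)).take i).flatten.reverse : Store }.get)
    fun i => ?_
  · simpa [Prog.round, take_ofFn_self, encodeMatrix] using h.runs
  · rw [take_ofFn_succ, List.flatten_append, List.flatten_singleton, List.reverse_append]
    exact consumes_roundLetter_row e (B i) (hℓ i) { graph := g, count := u, word := _ }

/-! ### Extracting an independent set -/

/-- The vertices of `p` that have no neighbor in `p`. -/
def isolated {n : ℕ} (adj : Fin n → Fin n → Bool) (p : Fin n → Bool) (i : Fin n) : Bool :=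
  p i && !(List.ofFn fun j => decide (markedEntry adj i j = .bit true) && p j).any id

/-- The number of bits that are set. -/
def ones (w : List Letter) : ℕ := w.count (.bit true)

namespace Prog

/-- Read a letter of the marked adjacency matrix, and write at the end of each row whether its
vertex is isolated in the set with indicator vector `row`. -/
def selectLetter : Prog Letter Stack :=
  pushCur .graph ;; .ite (isCur .newline)
    (.pop .diag ;; .push .sel (fun r => .bit (isCur (.bit true) r && !r.flag)) ;;
      .load (fun r => { r with flag := false }) ;; move .row' .row)
    (.ite (isCur (.bit true))
      (.pop .row ;; pushCur .row' ;;
        .load fun r => { r with flag := r.flag || isCur (.bit true) r })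
      (.pop .row ;; pushCur .row'))

/-- Move up to `m` letters from `count` to `count'`. -/
def transfer : ℕ → Prog Letter Stack
  | 0 => skip
  | m + 1 => (.pop .count ;; .ite (fun r => r.cur.isSome) (pushCur .count') skip) ;; transfer m

/-- Transfer `R` letters for each bit that is set. -/
def tallyLetter (R : ℕ) : Prog Letter Stack :=
  pushCur .sel' ;; .ite (isCur (.bit true)) (transfer R) skip

/-- Read the next `n` bits. -/
def readChunk : Prog Letter Stack :=
  forPop .count (pushCur .count' ;; .pop .word' ;; pushCur .row' ;; pushCur .diag') ;;
    move .count' .count ;; move .diag' .diag ;; move .row' .row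

/-- Write the indicator vector of the isolated vertices to `out`, if there are at least `n / R`. -/
def keepIfLarge (R : ℕ) : Prog Letter Stack :=
  forPop .sel (tallyLetter R) ;; .pop .count ;;
    .ite (fun r => r.cur.isNone) (clear .out ;; move .sel' .sel ;; move .sel .out)
      (pushCur .count ;; clear .sel') ;;
    move .count' .count

/-- Handle `n` bits. The first of them has been popped already by the enclosing loop. -/
def processChunk (R : ℕ) : Prog Letter Stack :=
  pushCur .word' ;; readChunk ;; move .graph .graph' ;; forPop .graph' selectLetter ;;
    clear .row ;; keepIfLarge R

end Prog

@[simp] theorem length_bitWord {n : ℕ} (p : Fin n → Bool) : (bitWord p).length = n := by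
  simp [bitWord]

theorem drop_bitWord {n : ℕ} (p : Fin n → Bool) (j : Fin n) :
    (bitWord p).drop j = .bit (p j) :: (bitWord p).drop (j + 1) := by
  rw [List.drop_eq_getElem_cons (by simp)]
  simp [bitWord]

theorem unary_eq_ofFn (n : ℕ) : unary n = List.ofFn fun _ : Fin n => Letter.comma := by
  simp [unary, List.ofFn_const]

theorem runs_readChunk {n : ℕ} (p : Fin n → Bool) (g w o : List Letter) (r : Reg Letter) :
    Runs readChunk r
      { graph := g, count := unary n, word' := bitWord p ++ w, out := o : Store }.get
      { r with cur := none }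
      { graph := g, count := unary n, row := bitWord p, diag := bitWord p, word' := w, out := o
        : Store }.get (4 * n + 4) := by
  have h := Consumes.ofFn (k := .count)
    (p := pushCur .count' ;; .pop .word' ;; pushCur .row' ;; pushCur .diag') (c := 0)
    (w := fun _ : Fin n => Letter.comma) (fun _ => r)
    (fun j => { graph := g, count' := unary j
                row' := ((bitWord p).take j).reverse, diag' := ((bitWord p).take j).reverse
                word' := (bitWord p).drop j ++ w, out := o : Store }.get)
    fun j v => ⟨some (.bit (p j)), ?_⟩
  · rw [← unary_eq_ofFn, take_bitWord_self] at h
    have hread := h.runs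
    simp only [Store.update_get, Store.set, List.take_zero, List.reverse_nil, List.drop_zero,
      unary_zero] at hread
    refine (hread.seq (.seq (.move (by decide)) (.seq (.move (by decide))
      (.move (by decide))))).of_eq rfl ?_ ?_
    · simp
    · simp
      omega
  · rw [take_bitWord_succ, drop_bitWord]
    refine .of_eq (.seq (.pushCur rfl) (.seq (.pop _) (.seq (.pushCur (a := .bit (p j)) ?_)
      (.pushCur (a := .bit (p j)) ?_)))) ?_ ?_ le_rfl
    all_goals simp [unary_succ]

section Select

variable {n : ℕ} (adj : Fin n → Fin n → Bool) (p : Fin n → Bool)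

theorem consumes_selectLetter_row (i : Fin n) (d : List Letter) (s : Store) :
    Consumes .graph' selectLetter (markedRow adj i)
      .init { s with row := bitWord p, row' := [], diag := .bit (p i) :: d }.get
      .init { s with
        graph := (markedRow adj i).reverse ++ s.graph, row := bitWord p, row' := [], diag := d
        sel := .bit (isolated adj p i) :: s.sel }.get (2 * n + 2) := by
  have h := Consumes.ofFn (k := .graph') (p := selectLetter) (c := 0) (w := markedEntry adj i)
    (fun j => ⟨none, ((List.ofFn fun j =>
      decide (markedEntry adj i j = .bit true) && p j).take j).any id, false⟩)
    (fun j => { s with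
      graph := ((List.ofFn (markedEntry adj i)).take j).reverse ++ s.graph
      row := (bitWord p).drop j, row' := ((bitWord p).take j).reverse
      diag := .bit (p i) :: d }.get)
    fun j v => ⟨some (.bit (p j)), ?_⟩
  · rw [take_ofFn_self, take_ofFn_self, take_bitWord_self] at h
    refine (h.append (Consumes.single (c := n + 1) fun v => ⟨none, ?_⟩)).mono (by omega)
    refine .of_eq (.seq (.pushCur rfl) (.ite_true rfl (.seq (.pop _) (.seq (.push _ _)
      (.seq (.load _) (.move (by decide))))))) rfl ?_ ?_
    · cases hp : p i <;> simp [markedRow, isolated, isCur, hp]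
    · simp
  · rw [take_bitWord_succ, take_ofFn_succ, take_ofFn_succ, drop_bitWord]
    have hnewline (f : Bool) := isCur_newline_markedEntry adj i j f false
    by_cases hentry : markedEntry adj i j = .bit true
    · refine .of_eq (.seq (.pushCur rfl) (.ite_false (hnewline _)
        (.ite_true (by simp [isCur, hentry]) (.seq (.pop _)
          (.seq (.pushCur (a := .bit (p j)) ?_) (.load _)))))) ?_ ?_ le_rfl
      all_goals simp [hentry, isCur]
    · refine .of_eq (.seq (.pushCur rfl) (.ite_false (hnewline _)
        (.ite_false (by simp [isCur, hentry]) (.seq (.pop _)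
          (.pushCur (a := .bit (p j)) ?_))))) ?_ ?_ le_rfl
      all_goals simp [hentry]

theorem runs_select (x : Option Letter) (w o : List Letter) :
    Runs (forPop .graph' selectLetter) ⟨x, false, false⟩
      { graph' := markedWord adj, count := unary n, row := bitWord p, diag := bitWord p,
        word' := w, out := o : Store }.get
      .init
      { graph := (markedWord adj).reverse, count := unary n, row := bitWord p, word' := w,
        sel := (bitWord (isolated adj p)).reverse, out := o : Store }.get
      (n * (2 * n + 2) + 1) := by
  have h := Consumes.ofFn_flatten (k := .graph') (p := selectLetter) (w := markedRow adj)
    (c := 2 * n + 2) (fun _ => .init)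
    (fun i => { graph := ((List.ofFn (markedRow adj)).take i).flatten.reverse, count := unary n
                row := bitWord p, diag := (bitWord p).drop i, word' := w
                sel := ((bitWord (isolated adj p)).take i).reverse, out := o : Store }.get)
    fun i => ?_
  · rw [take_ofFn_self, take_bitWord_self] at h
    simpa [markedWord, List.drop_eq_nil_of_le] using h.runs.forPop_cur (x := x)
  · rw [take_bitWord_succ, take_ofFn_succ, drop_bitWord]
    simpa using consumes_selectLetter_row adj p i ((bitWord p).drop (i + 1))
      { graph := ((List.ofFn (markedRow adj)).take i).flatten.reverse, count := unary n
        word' := w, sel := ((bitWord (isolated adj p)).take i).reverse, out := o }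

end Select

theorem runs_transfer (n m y : ℕ) (r : Reg Letter) (s : Store) :
    ∃ x, Runs (transfer m)
      r { s with count := unary (n - y), count' := unary (min n y) }.get
      { r with cur := x }
      { s with count := unary (n - (y + m)), count' := unary (min n (y + m)) }.get 0 := by
  induction m generalizing y r with
  | zero => exact ⟨r.cur, .skip⟩
  | succ m ih =>
    rcases lt_or_ge y n with hy | hy
    · obtain ⟨x, hx⟩ := ih (y + 1) { r with cur := some .comma }
      refine ⟨x, (Runs.seq_of_eq (.seq (.pop _) (.ite_true ?_ (.pushCur (a := .comma) ?_)))
        hx ?_ ?_).of_eq rfl ?_ le_rfl⟩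
      all_goals obtain ⟨q, rfl⟩ := Nat.exists_eq_add_of_lt hy
      all_goals simp [unary_succ, add_assoc, add_comm 1 m,
        show y + (q + 1) - (y + 1) = q by omega]
    · obtain ⟨x, hx⟩ := ih y { r with cur := none }
      refine ⟨x, (Runs.seq_of_eq (.seq (.pop _) (.ite_false ?_ .skip)) hx ?_ ?_).of_eq rfl ?_
        le_rfl⟩
      all_goals simp [show n - y = 0 by omega, show n - (y + m) = 0 by omega,
        show n - (y + (m + 1)) = 0 by omega, show n ≤ y + m by omega, show n ≤ y + (m + 1) by omega]

theorem consumes_tallyLetter (R n : ℕ) (u : List Letter) (y : ℕ) (s : Store) :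
    Consumes .sel (tallyLetter R) u
      .init { s with count := unary (n - y), count' := unary (min n y) }.get
      .init { s with
        count := unary (n - (y + R * ones u)), count' := unary (min n (y + R * ones u))
        sel' := u.reverse ++ s.sel' }.get u.length := by
  induction u generalizing s y with
  | nil => exact .nil
  | cons a u ih =>
    by_cases ha : a = .bit true
    · subst ha
      have hones : y + R + R * ones u = y + R * ones (.bit true :: u) := by
        simp [ones]
        ring
      refine ((ih (y + R) { s with sel' := .bit true :: s.sel' }).cons (c := 0)
        fun v => ?_).of_eq rfl (by simp [hones]) (by simp [add_comm])
      obtain ⟨x, hx⟩ := runs_transfer n R y ⟨some (.bit true), false, false⟩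
        { s with sel := v, sel' := .bit true :: s.sel' }
      exact ⟨x, .seq_of_eq (.pushCur rfl) (.ite_true rfl (hx.of_eq rfl (by simp) le_rfl)) rfl
        (by simp)⟩
    · have hones : ones (a :: u) = ones u := List.count_cons_of_ne (by simpa using ha)
      refine ((ih y { s with sel' := a :: s.sel' }).cons (c := 0) fun v => ⟨some a, .of_eq
        (.seq (.pushCur rfl) (.ite_false (by simp [isCur, ha]) .skip)) rfl (by simp)
        le_rfl⟩).of_eq rfl ?_ ?_
      · simp [hones]
      · simp [add_comm]

theorem runs_keepIfLarge (R : ℕ) (g u w o : List Letter) (ho : o.length ≤ u.length) :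
    Runs (keepIfLarge R)
      .init { graph := g, count := unary u.length, word' := w, sel := u.reverse, out := o
              : Store }.get
      .init { graph := g, count := unary u.length, word' := w
              out := if u.length ≤ R * ones u then u else o : Store }.get
      (5 * u.length + 6) := by
  have htally := (consumes_tallyLetter R u.length u.reverse 0
    { graph := g, word' := w, out := o }).runs
  have hones : ones u.reverse = ones u := List.count_reverse
  simp only [hones, List.length_reverse, zero_add, List.reverse_reverse, Store.update_get,
    Store.set, List.append_nil, Nat.sub_zero, Nat.min_zero, unary_zero] at htally
  split_ifs with hn
  · refine (htally.seq (.seq (.pop _) (.seq (.ite_true ?_ (.seq .clear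
      (.seq (.move (by decide)) (.move (by decide))))) (.move (by decide))))).of_eq rfl ?_ ?_
    all_goals simp [hn]
    omega
  · obtain ⟨q, hq⟩ : ∃ q, u.length - R * ones u = q + 1 := ⟨u.length - R * ones u - 1, by omega⟩
    have hcount : unary (min u.length (R * ones u)) ++ .comma :: unary q = unary u.length := by
      rw [← unary_succ, unary, unary, List.replicate_append_replicate, unary]
      congr 1
      omega
    refine (htally.seq (.seq (.pop _) (.seq (.ite_false ?_
      (.seq (.pushCur (a := .comma) ?_) .clear)) (.move (by decide))))).of_eq rfl ?_ ?_
    all_goals simp [hq, unary_succ, hcount]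
    omega

theorem runs_processChunk (R : ℕ) {n : ℕ} (adj : Fin n → Fin n → Bool) (p : Fin n → Bool)
    (w o : List Letter) (a : Letter) (v : List Letter) (hav : bitWord p ++ w = a :: v)
    (ho : o.length ≤ n) :
    Runs (processChunk R)
      ⟨some a, false, false⟩
      { graph := (markedWord adj).reverse, count := unary n, word' := v, out := o : Store }.get
      .init
      { graph := (markedWord adj).reverse, count := unary n, word' := w
        out := if n ≤ R * ones (bitWord (isolated adj p)) then bitWord (isolated adj p) else o
        : Store }.get
      (3 * n * n + 20 * n + 20) := by
  have hmove : Runs (move .graph .graph') .init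
      { graph := (markedWord adj).reverse, count := unary n, row := bitWord p, diag := bitWord p
        word' := w, out := o : Store }.get .init
      { graph' := markedWord adj, count := unary n, row := bitWord p, diag := bitWord p
        word' := w, out := o : Store }.get (n * (n + 1) + 1) :=
    .of_eq (.move (by decide)) rfl (by simp) (by simp [length_markedWord])
  have hclear : Runs (clear .row) .init
      { graph := (markedWord adj).reverse, count := unary n, row := bitWord p, word' := w
        sel := (bitWord (isolated adj p)).reverse, out := o : Store }.get .init
      { graph := (markedWord adj).reverse, count := unary n, word' := w
        sel := (bitWord (isolated adj p)).reverse, out := o : Store }.get (n + 1) :=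
    .of_eq .clear rfl (by simp) (by simp)
  have hkeep := runs_keepIfLarge R (markedWord adj).reverse (bitWord (isolated adj p)) w o
    (by simpa using ho)
  rw [length_bitWord] at hkeep
  refine (Runs.seq_of_eq (.pushCur rfl) (.seq (runs_readChunk p _ w o ⟨some a, false, false⟩)
    (hmove.seq ((runs_select adj p none w o).seq (hclear.seq hkeep)))) rfl (by simp [hav])).mono ?_
  nlinarith

/-- The output after chunks of bits have been processed one after the other. -/
def lastLarge (R : ℕ) {n : ℕ} (adj : Fin n → Fin n → Bool) (o : List Letter)
    (c : List (Fin n → Bool)) : List Letter :=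
  c.foldl (fun o p =>
    if n ≤ R * ones (bitWord (isolated adj p)) then bitWord (isolated adj p) else o) o

theorem runs_processChunks (R : ℕ) {n : ℕ} (hn : 0 < n) (adj : Fin n → Fin n → Bool)
    (c : List (Fin n → Bool)) (o : List Letter) (ho : o.length ≤ n) :
    Runs (forPop .word' (processChunk R))
      .init
      { graph := (markedWord adj).reverse, count := unary n, word' := (c.map bitWord).flatten
        out := o : Store }.get
      .init
      { graph := (markedWord adj).reverse, count := unary n, out := lastLarge R adj o c
        : Store }.get
      (c.length * (3 * n * n + 20 * n + 21) + 1) := by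
  induction c generalizing o with
  | nil => exact (Runs.forPop_nil rfl).mono (by simp)
  | cons p c ih =>
    obtain ⟨a, v, hav⟩ : ∃ a v, bitWord p ++ (c.map bitWord).flatten = a :: v :=
      List.exists_cons_of_length_pos (by simp [hn])
    have hchunk := runs_processChunk R adj p (c.map bitWord).flatten o a v hav ho
    refine (Runs.forPop_cons (a := a) (v := v) (by simpa using hav) (by simpa using hchunk)
      (ih _ ?_)).mono ?_
    · dsimp only
      split_ifs <;> simp [ho]
    · rw [List.length_cons, Nat.succ_mul c.length]
      omega

theorem lastLarge_spec (R : ℕ) {n : ℕ} (adj : Fin n → Fin n → Bool) (o : List Letter)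
    (c : List (Fin n → Bool)) (h : ∃ p ∈ c, n ≤ R * ones (bitWord (isolated adj p))) :
    ∃ p, n ≤ R * ones (bitWord (isolated adj p)) ∧
      lastLarge R adj o c = bitWord (isolated adj p) := by
  induction c using List.reverseRecOn with
  | nil => simp at h
  | append_singleton c q ih =>
    rw [lastLarge, List.foldl_append, List.foldl_cons, List.foldl_nil]
    split_ifs with hq
    · exact ⟨q, hq, rfl⟩
    · obtain ⟨p, hp, hlarge⟩ := h
      rcases List.mem_append.1 hp with hp | hp
      · exact ih ⟨p, hp, hlarge⟩
      · exact absurd (List.mem_singleton.1 hp ▸ hlarge) hq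

/-! ### The reduction -/

namespace Prog

/-- From the word of a graph on `inp`, whose first letter is in the register, compute the word of
the block matrix, the marked adjacency matrix, and the number of vertices. -/
def prepare {ι : Type} (l : List ι) (E : ι → ι → Letter → List Letter) : Prog Letter Stack :=
  pushCur .inp ;; .load (fun _ => .init) ;; mark ;; emit l E

/-- From the completed matrix on `word'`, compute the independent set. -/
def extract (e R : ℕ) : Prog Letter Stack :=
  round e ;; move .word .word' ;; forPop .word' (processChunk R) ;; clear .graph ;; clear .count

/-- The reduction of the search for independent sets to matrix completion. The parameters are the
blocks of the matrix, the words of its entries, the precision of the rounding, and the inverse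
density of the independent set. The empty graph is answered without a call of the subroutine. -/
def reduction {ι : Type} (l : List ι) (E : ι → ι → Letter → List Letter) (e R : ℕ) :
    Prog Letter Stack :=
  .pop .inp ;; .ite (fun r => r.cur.isNone) skip
    (prepare l E ;; invoke .word .word' ;; extract e R)

end Prog

/-- The rounded matrix, cut into chunks of `n` bits. -/
def chunks (e : ℕ) {L n : ℕ} (B : Matrix (Fin (L * n)) (Fin (L * n)) ℚ) : List (Fin n → Bool) :=
  (List.ofFn fun i => List.ofFn fun b => fun j => isLarge e (B i (finProdFinEquiv (b, j)))).flatten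

theorem length_chunks (e : ℕ) {L n : ℕ} (B : Matrix (Fin (L * n)) (Fin (L * n)) ℚ) :
    (chunks e B).length = L * n * L := by
  simp [chunks, List.length_flatten, List.map_ofFn, Function.comp_def]

theorem ofFn_finProdFinEquiv {α : Type*} {L n : ℕ} (f : Fin (L * n) → α) :
    List.ofFn f = (List.ofFn fun b => List.ofFn fun j => f (finProdFinEquiv (b, j))).flatten := by
  rw [List.ofFn_mul]
  congr! 5 with b j
  simp [finProdFinEquiv, mul_comm, add_comm]

theorem flatten_map_bitWord_chunks (e : ℕ) {L n : ℕ}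
    (B : Matrix (Fin (L * n)) (Fin (L * n)) ℚ) :
    ((chunks e B).map bitWord).flatten =
      (List.ofFn fun i => bitWord fun j => isLarge e (B i j)).flatten := by
  rw [chunks, List.map_flatten, List.map_ofFn, List.flatten_flatten, List.map_ofFn]
  congr! 3 with i
  rw [bitWord, ofFn_finProdFinEquiv]
  simp [List.map_ofFn, Function.comp_def, bitWord]

theorem length_encodeRational_le {N : ℕ} (B : Matrix (Fin N) (Fin N) ℚ) (i j : Fin N) :
    (encodeRational (B i j) ++ [Letter.comma]).length ≤ (encodeMatrix encodeRational B).length :=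
  have hentry : List.Sublist (encodeRational (B i j) ++ [Letter.comma])
      (List.ofFn fun j => encodeRational (B i j) ++ [Letter.comma]).flatten :=
    List.sublist_flatten_of_mem (List.mem_ofFn.2 ⟨j, rfl⟩)
  (hentry.trans ((List.sublist_append_left _ _).trans
    (List.sublist_flatten_of_mem (List.mem_ofFn.2 ⟨i, rfl⟩)))).length_le

/-- A bound for the number of jumps of the preparation, for a graph on `n` vertices and `L` blocks.
The semiring is arbitrary, so that the bound can also be read as a polynomial in `n`. -/
def prepareCost {S : Type*} [Semiring S] (L n : S) : S :=
  n * (3 * n + 2) + 1 + L * (n * (n + 1) + 1 + (n * (2 * n + 2 + L * (2 * n + 2)) + 1))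

/-- A bound for the number of jumps of the extraction, if the word of the completed matrix has
length `y`. -/
def extractCost {S : Type*} [Semiring S] (L e n y : S) : S :=
  L * n * (L * n * (2 * y + e + 2) + 1) + 1 + (L * n * (L * n) + 1) +
    (L * n * L * (3 * n * n + 20 * n + 21) + 1) + (n * (n + 1) + 1) + (n + 1)

/-- A bound for the number of jumps of the reduction, if moreover the instance of matrix completion
has length `w`, and the subroutine takes `t` steps. -/
def reductionCost {S : Type*} [Semiring S] (L e n w t y : S) : S :=
  prepareCost L n + (w + t + 2 * y + 3) + extractCost L e n y

theorem runs_prepare {L n : ℕ} (E : Fin L → Fin L → Letter → List Letter)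
    (adj : Fin n → Fin n → Bool) {a : Letter} {v : List Letter}
    (hav : encodeMatrix (fun b : Bool => [Letter.bit b]) adj = a :: v) :
    Runs (prepare (List.finRange L) E)
      ⟨some a, false, false⟩ { inp := v : Store }.get
      .init { graph := (markedWord adj).reverse, count := unary n
              word := (blockMatrix (List.finRange L) E (markedEntry adj)).reverse : Store }.get
      (prepareCost L n) := by
  have hmark := runs_mark adj
  have hemit := runs_emit adj (List.finRange L) E
  rw [hav] at hmark
  have hpush : Runs (pushCur .inp) ⟨some a, false, false⟩ { inp := v : Store }.get
      ⟨some a, false, false⟩ { inp := a :: v : Store }.get 0 :=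
    .of_eq (.pushCur rfl) rfl (by simp) le_rfl
  exact (hpush.seq (.seq (.load _) (hmark.seq hemit))).mono (by simp [prepareCost])

theorem runs_extract {L n : ℕ} (e R : ℕ) (hn : 0 < n) (adj : Fin n → Fin n → Bool)
    (B : Matrix (Fin (L * n)) (Fin (L * n)) ℚ) :
    Runs (extract e R)
      .init { graph := (markedWord adj).reverse, count := unary n
              word' := encodeMatrix encodeRational B : Store }.get
      .init { out := lastLarge R adj [] (chunks e B) : Store }.get
      (extractCost L e n (encodeMatrix encodeRational B).length) := by
  have hround := runs_round e B (length_encodeRational_le B) (markedWord adj).reverse (unary n)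
  have hmove : Runs (move .word .word') .init
      { graph := (markedWord adj).reverse, count := unary n
        word := (List.ofFn fun i => bitWord fun j => isLarge e (B i j)).flatten.reverse
        : Store }.get .init
      { graph := (markedWord adj).reverse, count := unary n
        word' := ((chunks e B).map bitWord).flatten : Store }.get (L * n * (L * n) + 1) :=
    .of_eq (.move (by decide)) rfl (by simp [flatten_map_bitWord_chunks])
      (by simp [List.length_flatten, List.map_ofFn, Function.comp_def])
  have hchunks := runs_processChunks R hn adj (chunks e B) [] (Nat.zero_le _)
  have hclear : Runs (clear .graph ;; clear .count) .init
      { graph := (markedWord adj).reverse, count := unary n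
        out := lastLarge R adj [] (chunks e B) : Store }.get .init
      { out := lastLarge R adj [] (chunks e B) : Store }.get (n * (n + 1) + 1 + (n + 1)) :=
    .of_eq (.seq .clear .clear) rfl (by simp) (by simp [length_markedWord])
  rw [length_chunks] at hchunks
  refine (hround.seq (hmove.seq (hchunks.seq hclear))).mono (le_of_eq ?_)
  simp only [extractCost]
  ring

theorem exec_reduction_nil {T : TM2ComputableAux Letter Letter} {ι : Type} (l : List ι)
    (E : ι → ι → Letter → List Letter) (e R : ℕ) :
    Exec T (reduction l E e R) ⟨.init, ({} : Store).get, fun _ => []⟩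
      ⟨.init, ({} : Store).get, fun _ => []⟩ 0 := by
  have h : Runs (reduction l E e R) .init ({} : Store).get .init ({} : Store).get 0 :=
    .of_eq (.seq (.pop _) (.ite_true rfl (.load _))) rfl (by simp) le_rfl
  obtain ⟨c, hc, hexec⟩ := h T fun _ => []
  rwa [Nat.le_zero.1 hc] at hexec

theorem exec_reduction {T : TM2ComputableAux Letter Letter} {L : ℕ}
    (E : Fin L → Fin L → Letter → List Letter) (e R : ℕ) {n : ℕ} (hn : 0 < n)
    (adj : Fin n → Fin n → Bool) (B : Matrix (Fin (L * n)) (Fin (L * n)) ℚ) {t : ℕ}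
    (hT : TM2OutputsInTime T.tm
      ((blockMatrix (List.finRange L) E (markedEntry adj)).map T.inputAlphabet.symm)
      (some ((encodeMatrix encodeRational B).map T.outputAlphabet.symm)) t) :
    ∃ c ≤ reductionCost L e n (blockMatrix (List.finRange L) E (markedEntry adj)).length t
        (encodeMatrix encodeRational B).length,
      Exec T (reduction (List.finRange L) E e R)
        ⟨.init, { inp := encodeMatrix (fun b : Bool => [Letter.bit b]) adj : Store }.get,
          fun _ => []⟩
        ⟨.init, { out := lastLarge R adj [] (chunks e B) : Store }.get, fun _ => []⟩ c := by
  obtain ⟨a, v, hav⟩ : ∃ a v, encodeMatrix (fun b : Bool => [Letter.bit b]) adj = a :: v :=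
    List.exists_cons_of_length_pos <| by
      simp [encodeMatrix, List.length_flatten, List.map_ofFn, Function.comp_def, hn]
  have hpop : Runs (.pop .inp) .init { inp := a :: v : Store }.get
      ⟨some a, false, false⟩ { inp := v : Store }.get 0 :=
    .of_eq (.pop _) rfl (by simp) le_rfl
  obtain ⟨c₀, hc₀, hpop⟩ := hpop T fun _ => []
  obtain ⟨c₁, hc₁, hprepare⟩ := runs_prepare E adj hav T fun _ => []
  obtain ⟨c₂, hc₂, hinvoke⟩ := Exec.invoke (i := Stack.word) (o := .word') (by decide) hT .init
    { graph := (markedWord adj).reverse, count := unary n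
      word := (blockMatrix (List.finRange L) E (markedEntry adj)).reverse : Store }.get rfl rfl
  simp only [Store.update_get, Store.set] at hinvoke
  obtain ⟨c₃, hc₃, hextract⟩ := runs_extract e R hn adj B T fun _ => []
  rw [hav]
  refine ⟨_, ?_, hpop.seq (.ite_false rfl (hprepare.seq (hinvoke.seq hextract)))⟩
  rw [reductionCost]
  omega

/-! ### Correctness and running time of the reduction -/

/-- The matrix with blocks indexed by `Fin L`, whose entry in the block `(a, b)` at `(i, j)` is
`ent a b (x i j)`. -/
def blowUp {β : Type*} {L n : ℕ} (ent : Fin L → Fin L → β → Option ℚ) (x : Fin n → Fin n → β) :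
    Matrix (Fin (L * n)) (Fin (L * n)) (Option ℚ) := fun I J =>
  ent (finProdFinEquiv.symm I).1 (finProdFinEquiv.symm J).1
    (x (finProdFinEquiv.symm I).2 (finProdFinEquiv.symm J).2)

theorem blowUp_finProdFinEquiv {β : Type*} {L n : ℕ} (ent : Fin L → Fin L → β → Option ℚ)
    (x : Fin n → Fin n → β) (a b : Fin L) (i j : Fin n) :
    blowUp ent x (finProdFinEquiv (a, i)) (finProdFinEquiv (b, j)) = ent a b (x i j) := by
  simp [blowUp]

theorem encodeMatrix_blowUp {L n : ℕ} (ent : Fin L → Fin L → Letter → Option ℚ)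
    (x : Fin n → Fin n → Letter) :
    encodeMatrix encodeEntry (blowUp ent x) =
      blockMatrix (List.finRange L) (fun a b z => encodeEntry (ent a b z) ++ [.comma]) x := by
  rw [encodeMatrix, ofFn_finProdFinEquiv, blockMatrix, List.flatten_flatten, List.map_ofFn,
    ← List.ofFn_eq_map]
  congr! 3 with a
  rw [Function.comp_apply, blockBand]
  congr! 3 with i
  rw [ofFn_finProdFinEquiv, blockRow, List.flatten_flatten, List.map_ofFn, ← List.ofFn_eq_map]
  simp only [blowUp_finProdFinEquiv, rowImage, Function.comp_def]

theorem length_flatten_ofFn_le {α : Type*} {N c : ℕ} (w : Fin N → List α)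
    (h : ∀ i, (w i).length ≤ c) : (List.ofFn w).flatten.length ≤ N * c := by
  rw [List.length_flatten, List.map_ofFn, List.sum_ofFn]
  simpa using Finset.sum_le_card_nsmul Finset.univ (fun i => (w i).length) c fun i _ => h i

theorem exists_length_blowUp_le {β : Type*} [Finite β] {L : ℕ}
    (ent : Fin L → Fin L → β → Option ℚ) :
    ∃ C, ∀ (n : ℕ) (x : Fin n → Fin n → β),
      (encodeMatrix encodeEntry (blowUp ent x)).length ≤ L * n * (L * n * C + 1) := by
  obtain ⟨C, hC⟩ := Finite.exists_le fun z : Fin L × Fin L × β =>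
    (encodeEntry (ent z.1 z.2.1 z.2.2) ++ [Letter.comma]).length
  refine ⟨C, fun n x => length_flatten_ofFn_le _ fun I => ?_⟩
  rw [List.length_append, List.length_singleton]
  exact Nat.add_le_add_right (length_flatten_ofFn_le _ fun J => hC (_, _, _)) 1

open Classical in
/-- The adjacency matrix of a graph, with Boolean entries. -/
noncomputable def adjacency {n : ℕ} (G : SimpleGraph (Fin n)) (i j : Fin n) : Bool :=
  decide (G.Adj i j)

theorem adjacency_eq_true {n : ℕ} {G : SimpleGraph (Fin n)} {i j : Fin n} :
    adjacency G i j = true ↔ G.Adj i j := by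
  simp [adjacency]

theorem le_length_encodeGraph {n : ℕ} (G : SimpleGraph (Fin n)) : n ≤ (encodeGraph G).length := by
  simpa [encodeGraph, encodeMatrix, List.length_flatten, List.map_ofFn, Function.comp_def] using
    Nat.le_mul_of_pos_right n (Nat.succ_pos _)

theorem monotone_eval_nat (p : Polynomial ℕ) : Monotone fun x => p.eval x := by
  intro x y h
  simp only [Polynomial.eval_eq_sum_range]
  gcongr

theorem reductionCost_mono {L e n w w' t t' y y' : ℕ} (hw : w ≤ w') (ht : t ≤ t') (hy : y ≤ y') :
    reductionCost L e n w t y ≤ reductionCost L e n w' t' y' := by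
  unfold reductionCost extractCost
  gcongr

theorem eval_reductionCost (L e n w t y : Polynomial ℕ) (x : ℕ) :
    (reductionCost L e n w t y).eval x =
      reductionCost (L.eval x) (e.eval x) (n.eval x) (w.eval x) (t.eval x) (y.eval x) := by
  simp [reductionCost, prepareCost, extractCost]

theorem exists_time_reduction (T : TM2ComputableAux Letter Letter) (time : Polynomial ℕ) {L : ℕ}
    (ent : Fin L → Fin L → Letter → Option ℚ) (e R : ℕ) :
    ∃ P : Polynomial ℕ, 0 < P.eval 0 ∧ ∀ (n : ℕ) (G : SimpleGraph (Fin n)), 0 < n →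
      ∀ B : Matrix (Fin (L * n)) (Fin (L * n)) ℚ,
      let v := encodeMatrix encodeEntry (blowUp ent (markedEntry (adjacency G)))
      Nonempty (TM2OutputsInTime T.tm (v.map T.inputAlphabet.symm)
        (some ((encodeMatrix encodeRational B).map T.outputAlphabet.symm)) (time.eval v.length)) →
      ∃ c < P.eval (encodeGraph G).length,
        Exec T (reduction (List.finRange L) (fun a b z => encodeEntry (ent a b z) ++ [.comma]) e R)
          ⟨.init, { inp := encodeGraph G : Store }.get, fun _ => []⟩
          ⟨.init, { out := lastLarge R (adjacency G) [] (chunks e B) : Store }.get, fun _ => []⟩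
          c := by
  obtain ⟨C, hC⟩ := exists_length_blowUp_le ent
  obtain ⟨D, hD⟩ := exists_length_output_le T
  let w : Polynomial ℕ := L * .X * (L * .X * C + 1)
  let t : Polynomial ℕ := time.comp w
  refine ⟨reductionCost (L : Polynomial ℕ) e .X w t (w + t * D) + 1, by simp, ?_⟩
  rintro n G hn B v ⟨hT⟩
  have hv : v.length ≤ w.eval n := by simpa [w] using hC n (markedEntry (adjacency G))
  have ht : time.eval v.length ≤ t.eval n := by
    simpa [t] using monotone_eval_nat time hv
  have hy : (encodeMatrix encodeRational B).length ≤ (w + t * (D : Polynomial ℕ)).eval n := by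
    simpa using (hD _ _ _ ⟨hT⟩).trans (Nat.add_le_add hv (Nat.mul_le_mul_right D ht))
  have hvE : v = blockMatrix (List.finRange L) _ (markedEntry (adjacency G)) :=
    encodeMatrix_blowUp ent _
  rw [hvE] at hT hv ht
  obtain ⟨c, hc, hexec⟩ := exec_reduction _ e R hn (adjacency G) B hT
  refine ⟨c, ?_, hexec⟩
  calc c ≤ (reductionCost (L : Polynomial ℕ) e .X w t (w + t * D)).eval n := by
        rw [eval_reductionCost]
        simpa using hc.trans (reductionCost_mono hv ht hy)
    _ < (reductionCost (L : Polynomial ℕ) e .X w t (w + t * D) + 1).eval n := by simp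
    _ ≤ _ := monotone_eval_nat _ (le_length_encodeGraph G)

theorem isolated_iff {n : ℕ} (adj : Fin n → Fin n → Bool) (p : Fin n → Bool) (i : Fin n) :
    isolated adj p i = true ↔ p i = true ∧ ∀ j, j ≠ i → adj i j = true → p j = false := by
  simp only [isolated, markedEntry, Bool.and_eq_true, Bool.not_eq_true', List.any_eq_false,
    List.forall_mem_ofFn_iff, id]
  refine and_congr_right fun _ => forall_congr' fun j => ?_
  obtain rfl | h := eq_or_ne i j
  · simp
  · simp [h, h.symm]

theorem isIndepSet_isolated {n : ℕ} (G : SimpleGraph (Fin n)) (p : Fin n → Bool) :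
    G.IsIndepSet {i | isolated (adjacency G) p i = true} := by
  intro i hi j hj hij hadj
  have hpj := ((isolated_iff _ _ _).1 hi).2 j hij.symm (adjacency_eq_true.2 hadj)
  exact Bool.false_ne_true (hpj.symm.trans ((isolated_iff _ _ _).1 hj).1)

theorem bitWord_eq_encodeVertexSet {n : ℕ} (p : Fin n → Bool) :
    bitWord p = encodeVertexSet {i | p i = true} := by
  simp [bitWord, encodeVertexSet]

theorem ones_bitWord {n : ℕ} (p : Fin n → Bool) : ones (bitWord p) = #{i | p i = true} := by
  rw [ones, bitWord, List.count, List.ofFn_eq_map, List.countP_map,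
    List.countP_eq_length_filter]
  change _ = (List.filter (fun i => decide (p i = true)) (List.finRange n)).length
  congr 2
  funext i
  cases h : p i <;> simp [h]

theorem isSolution_isolated {k R n : ℕ} (hR : 0 < R) {G : SimpleGraph (Fin n)} {p : Fin n → Bool}
    (hp : n ≤ R * ones (bitWord (isolated (adjacency G) p))) :
    (independentSetProblem k R).IsSolution ⟨n, G⟩
      (Finset.univ.filter fun i : Fin n => isolated (adjacency G) p i = true) := by
  refine ⟨by simpa using isIndepSet_isolated G p, ?_⟩
  rw [ones_bitWord] at hp
  rw [div_le_iff₀' (by exact_mod_cast hR)]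
  exact_mod_cast hp

theorem nonempty_outputsInTime_computer {T : TM2ComputableAux Letter Letter}
    {p : Prog Letter Stack} {w v : List Letter} {c N : ℕ}
    (h : Exec T p ⟨.init, { inp := w : Store }.get, fun _ => []⟩
      ⟨.init, { out := v : Store }.get, fun _ => []⟩ c) (hc : c < N) :
    Nonempty (TM2OutputsInTime (p.computer T .inp .out).tm
      (w.map (p.computer T .inp .out).inputAlphabet.symm)
      (some (v.map (p.computer T .inp .out).outputAlphabet.symm)) N) := by
  have hnil : (fun _ => []) = ({} : Store).get := by
    funext k
    cases k <;> rfl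
  refine Exec.outputsInTime (n := c) ?_ hc
  rwa [hnil, Store.update_get, Store.update_get]

theorem solvableInPolyTime_of_blowUp {k k' r R : ℕ} {p ε c μ : ℝ}
    (hQ : (completionProblem k r p ε c μ).SolvableInPolyTime) {L : ℕ}
    (ent : Fin L → Fin L → Letter → Option ℚ) (e : ℕ) (hR : 0 < R)
    (hprom : ∀ (n : ℕ) (G : SimpleGraph (Fin n)), 0 < n → G.Colorable k' →
      (completionProblem k r p ε c μ).Promise ⟨L * n, blowUp ent (markedEntry (adjacency G))⟩)
    (hsol : ∀ (n : ℕ) (G : SimpleGraph (Fin n)) (B : Matrix (Fin (L * n)) (Fin (L * n)) ℚ), 0 < n →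
      (completionProblem k r p ε c μ).IsSolution
        ⟨L * n, blowUp ent (markedEntry (adjacency G))⟩ B →
      ∃ q ∈ chunks e B, n ≤ R * ones (bitWord (isolated (adjacency G) q))) :
    (independentSetProblem k' R).SolvableInPolyTime := by
  obtain ⟨T, time, hT⟩ := hQ
  obtain ⟨P, hP₀, hP⟩ := exists_time_reduction T time ent e R
  refine ⟨(reduction (List.finRange L) (fun a b z => encodeEntry (ent a b z) ++ [.comma]) e
    R).computer T .inp .out, P, ?_⟩
  rintro ⟨n, G⟩ hG
  obtain rfl | hn := n.eq_zero_or_pos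
  · refine ⟨(∅ : Finset (Fin 0)), ⟨by simp, by simp⟩, ?_⟩
    exact nonempty_outputsInTime_computer (exec_reduction_nil _ _ e R) hP₀
  · obtain ⟨B, hB, hout⟩ := hT ⟨L * n, _⟩ (hprom n G hn hG)
    obtain ⟨c, hc, hexec⟩ := hP n G hn B hout
    obtain ⟨q, hq, hlast⟩ := lastLarge_spec R (adjacency G) [] _ (hsol n G B hn hB)
    refine ⟨_, isSolution_isolated hR hq, ?_⟩
    rw [hlast, bitWord_eq_encodeVertexSet] at hexec
    exact nonempty_outputsInTime_computer hexec hc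

/-! ### Covering the rows of a matrix of low rank -/

section Cover

variable (E : Type*) [NormedAddCommGroup E] [NormedSpace ℝ E] [FiniteDimensional ℝ E]

theorem packingNumber_closedBall_two_le :
    Metric.packingNumber 1 (Metric.closedBall (0 : E) 2) ≤ 5 ^ Module.finrank ℝ E := by
  refine iSup₂_le fun C hC => iSup_le fun hsep => ?_
  by_contra! hlt
  obtain ⟨S, hSC, hS⟩ := Set.exists_subset_encard_eq (Order.add_one_le_of_lt hlt)
  obtain ⟨s, rfl⟩ := (Set.finite_of_encard_eq_coe (k := 5 ^ Module.finrank ℝ E + 1)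
    (by simpa using hS)).exists_finset_coe
  have hcard := Besicovitch.card_le_of_separated s
    (fun c hc => by simpa using hC (hSC hc)) fun c hc d hd hcd => ?_
  · rw [Set.encard_coe_eq_coe_finsetCard] at hS
    have : #s = 5 ^ Module.finrank ℝ E + 1 := by exact_mod_cast hS
    omega
  · have h : 1 < edist c d := by simpa using hsep (hSC hc) (hSC hd) hcd
    rw [edist_dist, ENNReal.one_lt_ofReal, dist_eq_norm] at h
    exact h.le

theorem exists_finset_cover_closedBall_two :
    ∃ t : Finset E, #t ≤ 5 ^ Module.finrank ℝ E ∧ ∀ x, ‖x‖ ≤ 2 → ∃ c ∈ t, ‖x - c‖ ≤ 1 := by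
  have hle := (Metric.coveringNumber_le_packingNumber 1 _).trans (packingNumber_closedBall_two_le E)
  obtain ⟨C, -, hfin, hcover, hC⟩ := Metric.exists_set_encard_eq_coveringNumber
    (ne_top_of_le_ne_top (by simp) hle)
  lift C to Finset E using hfin
  rw [← hC, Set.encard_coe_eq_coe_finsetCard] at hle
  refine ⟨C, by exact_mod_cast hle, fun x hx => ?_⟩
  have hxC := Metric.isCover_iff_subset_iUnion_closedBall.1 hcover
    (mem_closedBall_zero_iff.2 hx)
  simpa [dist_eq_norm] using hxC

theorem exists_finset_cover_closedBall_two_pow (m : ℕ) :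
    ∃ t : Finset E, #t ≤ (5 ^ Module.finrank ℝ E) ^ m ∧
      ∀ x, ‖x‖ ≤ 2 ^ m → ∃ c ∈ t, ‖x - c‖ ≤ 1 := by
  classical
  induction m with
  | zero => exact ⟨{0}, by simp, by simp⟩
  | succ m ih =>
    obtain ⟨s, hs, hs_cover⟩ := exists_finset_cover_closedBall_two E
    obtain ⟨t, ht, ht_cover⟩ := ih
    refine ⟨Finset.image₂ (fun c c' => (2 : ℝ) ^ m • c + c') s t, ?_, fun x hx => ?_⟩
    · rw [pow_succ']
      exact (Finset.card_image₂_le _ s t).trans (Nat.mul_le_mul hs ht)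
    · have h2 : (0 : ℝ) < 2 ^ m := by positivity
      obtain ⟨c, hc, hxc⟩ := hs_cover (((2 : ℝ) ^ m)⁻¹ • x) <| by
        rwa [norm_smul, norm_inv, Real.norm_of_nonneg h2.le, inv_mul_le_iff₀ h2, ← pow_succ]
      obtain ⟨c', hc', hxc'⟩ := ht_cover (x - (2 : ℝ) ^ m • c) <| by
        calc ‖x - (2 : ℝ) ^ m • c‖ = ‖(2 : ℝ) ^ m • (((2 : ℝ) ^ m)⁻¹ • x - c)‖ := by
              rw [smul_sub, smul_inv_smul₀ h2.ne']
          _ = 2 ^ m * ‖((2 : ℝ) ^ m)⁻¹ • x - c‖ := by rw [norm_smul, Real.norm_of_nonneg h2.le]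
          _ ≤ 2 ^ m := mul_le_of_le_one_right h2.le hxc
      exact ⟨_, Finset.mem_image₂_of_mem hc hc', by rwa [← sub_sub]⟩

end Cover

theorem exists_row_classes (r : ℕ) (c : ℝ) {δ : ℝ} (hδ : 0 < δ) :
    ∃ Q : ℕ, 0 < Q ∧ ∀ {ι κ : Type} [Fintype ι] [Fintype κ] (C : Matrix ι κ ℝ), C.rank ≤ r →
      (∀ i j, |C i j| ≤ c) → ∃ f : ι → Fin Q, ∀ i i', f i = f i' → ∀ j, |C i j - C i' j| ≤ δ := by
  obtain ⟨m, hm⟩ := pow_unbounded_of_one_lt (2 / δ * c) (one_lt_two (α := ℝ))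
  refine ⟨(5 ^ r) ^ m, by positivity, fun {ι κ} _ _ C hC hc => ?_⟩
  rw [Matrix.rank_eq_finrank_span_row] at hC
  have h2 : 0 < 2 / δ := by positivity
  let x (i) : Submodule.span ℝ (Set.range C.row) :=
    ⟨(2 / δ) • C.row i, Submodule.smul_mem _ _ (Submodule.subset_span ⟨i, rfl⟩)⟩
  have hx (i) : ‖x i‖ ≤ 2 ^ m := by
    refine (pi_norm_le_iff_of_nonneg (by positivity)).2 fun j => ?_
    calc ‖2 / δ * C i j‖ = 2 / δ * |C i j| := by rw [norm_mul, Real.norm_of_nonneg h2.le]; rfl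
      _ ≤ 2 / δ * c := by gcongr; exact hc i j
      _ ≤ 2 ^ m := hm.le
  obtain ⟨t, ht, hcover⟩ := exists_finset_cover_closedBall_two_pow
    (Submodule.span ℝ (Set.range C.row)) m
  choose y hyt hy using fun i => hcover (x i) (hx i)
  have hcard : #t ≤ (5 ^ r) ^ m := ht.trans (by gcongr; norm_num)
  refine ⟨fun i => Fin.castLE hcard (t.equivFin ⟨y i, hyt i⟩), fun i i' h j => ?_⟩
  have hyy : y i = y i' := by simpa using h
  have hdist : ‖x i - x i'‖ ≤ 2 := calc
    ‖x i - x i'‖ ≤ ‖x i - y i‖ + ‖y i - x i'‖ := norm_sub_le_norm_sub_add_norm_sub _ _ _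
    _ ≤ 1 + 1 := add_le_add (hy i) (by rw [hyy, norm_sub_rev]; exact hy i')
    _ = 2 := one_add_one_eq_two
  have hj : 2 / δ * |C i j - C i' j| ≤ 2 := calc
    2 / δ * |C i j - C i' j| = ‖2 / δ * C i j - 2 / δ * C i' j‖ := by
      rw [← mul_sub, norm_mul, Real.norm_of_nonneg h2.le, Real.norm_eq_abs]
    _ ≤ 2 := (norm_le_pi_norm (x i - x i' : κ → ℝ) j).trans hdist
  rwa [div_mul_eq_mul_div, div_le_iff₀ hδ, mul_le_mul_iff_right₀ two_pos] at hj

/-! ### The rounding test -/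

theorem isLarge_iff_of_pos {e : ℕ} {q : ℚ} (hq : 0 < q) :
    isLarge e q = true ↔ q.den.size ≤ q.num.natAbs.size + e := by
  simp [isLarge, hq]

theorem natAbs_num_eq_mul_den {q : ℚ} (hq : 0 < q) : (q.num.natAbs : ℚ) = q * q.den := by
  rw [Rat.mul_den_eq_num, Nat.cast_natAbs, abs_of_pos (Rat.num_pos.2 hq)]

theorem isLarge_of_le {e : ℕ} {q : ℚ} (h : 1 ≤ q * 2 ^ e) : isLarge e q = true := by
  have hq : 0 < q := pos_of_mul_pos_left (zero_lt_one.trans_le h) (by positivity)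
  have hden : (q.den : ℚ) ≤ (q.num.natAbs * 2 ^ e : ℕ) := calc
    (q.den : ℚ) ≤ q * 2 ^ e * q.den := le_mul_of_one_le_left q.den.cast_nonneg h
    _ = (q.num.natAbs * 2 ^ e : ℕ) := by push_cast [natAbs_num_eq_mul_den hq]; ring
  rw [isLarge_iff_of_pos hq, ← Nat.size_shiftLeft (by simpa using hq.ne'), Nat.shiftLeft_eq]
  exact Nat.size_le_size (by exact_mod_cast hden)

theorem isLarge_eq_false {e : ℕ} {q : ℚ} (h : q * 2 ^ (e + 1) ≤ 1) : isLarge e q = false := by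
  by_contra! hlarge
  have hq : 0 < q := by
    simp only [isLarge, Bool.not_eq_false, decide_eq_true_eq] at hlarge
    exact hlarge.1
  have hsize := (isLarge_iff_of_pos hq).1 (by simpa using hlarge)
  have hpos : 0 < q.num.natAbs.size := Nat.size_pos.2 (by simpa using hq.ne')
  have hden : q.den < q.num.natAbs * 2 ^ (e + 1) := calc
    q.den < 2 ^ q.den.size := Nat.lt_size_self _
    _ ≤ 2 ^ (q.num.natAbs.size + e) := Nat.pow_le_pow_right two_pos hsize
    _ = 2 ^ (q.num.natAbs.size - 1) * 2 ^ (e + 1) := by rw [← pow_add]; congr 1; omega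
    _ ≤ _ := Nat.mul_le_mul_right _ (Nat.lt_size.1 (Nat.sub_one_lt hpos.ne'))
  have hlt : (q.den : ℚ) < q * 2 ^ (e + 1) * q.den := calc
    (q.den : ℚ) < (q.num.natAbs * 2 ^ (e + 1) : ℕ) := by exact_mod_cast hden
    _ = q * 2 ^ (e + 1) * q.den := by push_cast [natAbs_num_eq_mul_den hq]; ring
  exact hlt.not_ge (mul_le_of_le_one_left q.den.cast_nonneg h)

/-! ### The matrix of a coloring -/

section ColorMatrix

open Matrix

variable {ι κ : Type*} [DecidableEq κ]

/-- The matrix with entry `d` at the pairs of equal color, and `0` elsewhere. -/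
def colorMatrix (d : ℝ) (col : ι → κ) : Matrix ι ι ℝ := fun i j => if col i = col j then d else 0

theorem colorMatrix_eq_submatrix (d : ℝ) (col : ι → κ) :
    colorMatrix d col = (diagonal fun _ => d).submatrix col col := by
  ext i j
  rw [colorMatrix, submatrix_apply, diagonal_apply]

theorem rank_colorMatrix [Fintype ι] [Fintype κ] {d : ℝ} (hd : d ≠ 0) {col : ι → κ}
    (hcol : Function.Surjective col) : (colorMatrix d col).rank = Fintype.card κ := by
  have hrank : (diagonal fun _ : κ => d).rank = Fintype.card κ := by
    rw [rank_diagonal, Fintype.card_congr (Equiv.subtypeUnivEquiv fun _ => hd)]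
  obtain ⟨g, hg⟩ := hcol.hasRightInverse
  refine le_antisymm ?_ ?_
  · rw [colorMatrix_eq_submatrix, ← hrank]
    exact rank_submatrix_le _ _ _
  · rw [← hrank]
    have : (diagonal fun _ : κ => d) = (colorMatrix d col).submatrix g g := by
      rw [colorMatrix_eq_submatrix, submatrix_submatrix, hg.comp_eq_id, submatrix_id_id]
    rw [this]
    exact rank_submatrix_le _ _ _

variable [Fintype ι]

/-- The normalized indicator vectors of the colors, as columns. -/
noncomputable def colorBasis (col : ι → κ) : Matrix ι κ ℝ := fun i q =>
  if col i = q then (√(#{i | col i = q} : ℝ))⁻¹ else 0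

theorem colorBasis_sq (col : ι → κ) (i : ι) (q : κ) :
    colorBasis col i q ^ 2 = if col i = q then (#{i | col i = q} : ℝ)⁻¹ else 0 := by
  rw [colorBasis, ite_pow, inv_pow, Real.sq_sqrt (Nat.cast_nonneg _), zero_pow two_ne_zero]

theorem transpose_mul_colorBasis {col : ι → κ} (hcol : Function.Surjective col) :
    (colorBasis col)ᵀ * colorBasis col = 1 := by
  ext q q'
  simp only [mul_apply, transpose_apply]
  obtain rfl | h := eq_or_ne q q'
  · obtain ⟨i, hi⟩ := hcol q
    have hcard : (#{i | col i = q} : ℝ) ≠ 0 :=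
      Nat.cast_ne_zero.2 (Finset.card_ne_zero_of_mem (Finset.mem_filter.2 ⟨Finset.mem_univ i, hi⟩))
    simp only [← sq, colorBasis_sq, one_apply_eq, ← Finset.sum_filter, Finset.sum_const,
      nsmul_eq_mul, mul_inv_cancel₀ hcard]
  · rw [one_apply_ne h]
    refine Finset.sum_eq_zero fun i _ => ?_
    by_cases hi : col i = q
    · rw [colorBasis, colorBasis, if_neg (hi ▸ h : col i ≠ q'), mul_zero]
    · rw [colorBasis, if_neg hi, zero_mul]

variable [Fintype κ]

theorem colorMatrix_eq_mul (d : ℝ) (col : ι → κ) :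
    colorMatrix d col =
      colorBasis col * diagonal (fun q => d * #{i | col i = q}) * (colorBasis col)ᵀ := by
  ext i j
  rw [mul_apply]
  simp only [mul_diagonal, transpose_apply]
  rw [Finset.sum_eq_single (col i) (fun q _ hq => by simp [colorBasis, hq.symm]) (by simp)]
  rw [colorMatrix]
  by_cases h : col i = col j
  · have hcard : (#{l | col l = col i} : ℝ) ≠ 0 :=
      Nat.cast_ne_zero.2 (Finset.card_ne_zero_of_mem (Finset.mem_filter.2 ⟨Finset.mem_univ i, rfl⟩))
    have hij : colorBasis col j (col i) = colorBasis col i (col i) := by simp [colorBasis, h]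
    rw [hij, if_pos h, mul_right_comm, ← sq, colorBasis_sq, if_pos rfl]
    field_simp
  · simp [colorBasis, h, eq_comm]

theorem sum_colorBasis_sq (col : ι → κ) (i : ι) :
    ∑ q, colorBasis col i q ^ 2 = (#{j | col j = col i} : ℝ)⁻¹ := by
  simp [colorBasis_sq]

end ColorMatrix

theorem hasCoherence_colorMatrix {N k : ℕ} {d μ : ℝ} (hd : 0 < d) {col : Fin N → Fin k}
    (hsurj : Function.Surjective col) (hcol : ∀ q, (N : ℝ) ≤ k * μ * #{i | col i = q}) :
    HasCoherence (colorMatrix d col) k μ := by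
  have hpos (q) : (0 : ℝ) < #{i | col i = q} := by
    obtain ⟨i, hi⟩ := hsurj q
    exact Nat.cast_pos.2 (Finset.card_pos.2 ⟨i, Finset.mem_filter.2 ⟨Finset.mem_univ i, hi⟩⟩)
  have hrow (i) : √(∑ q, colorBasis col i q ^ 2) ≤ √(k * μ / N) := by
    have hN : (0 : ℝ) < N := Nat.cast_pos.2 i.pos
    rw [sum_colorBasis_sq]
    refine Real.sqrt_le_sqrt ?_
    rw [inv_eq_one_div, div_le_div_iff₀ (hpos _) hN, one_mul]
    exact hcol _
  exact ⟨colorBasis col, colorBasis col, fun q => d * #{i | col i = q},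
    transpose_mul_colorBasis hsurj, transpose_mul_colorBasis hsurj, fun q => mul_pos hd (hpos q),
    colorMatrix_eq_mul d col, hrow, hrow⟩

/-! ### The completion instance of a graph -/

/-- The entry between two vertices of a graph: the diagonal is `d`, edges are `0`, and non-edges are
hidden. -/
def vertexEntry (d : ℚ) : Letter → Option ℚ
  | .bot => some d
  | .bit true => some 0
  | _ => none

/-- The entry between two blocks. A block without a color is a copy of the vertex set of the graph,
a block with a color consists of isolated vertices of that color. -/
def blockEntry {L : ℕ} {κ : Type*} [DecidableEq κ] (d : ℚ) (color : Fin L → Option κ)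
    (a b : Fin L) (x : Letter) : Option ℚ :=
  match color a, color b with
  | none, none => vertexEntry d x
  | some q, some q' => some (if q = q' then d else 0)
  | _, _ => none

/-- The color of a vertex in a blow-up: the color of its block, or, in a copy of the graph, its
color in the coloring `χ` of the graph. -/
def blowUpColor {L n : ℕ} {κ : Type*} (color : Fin L → Option κ) (χ : Fin n → κ)
    (I : Fin (L * n)) : κ :=
  (color (finProdFinEquiv.symm I).1).getD (χ (finProdFinEquiv.symm I).2)

theorem markedEntry_adjacency_comm {n : ℕ} (G : SimpleGraph (Fin n)) (i j : Fin n) :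
    markedEntry (adjacency G) i j = markedEntry (adjacency G) j i := by
  have hadj : adjacency G i j = adjacency G j i := by
    rw [Bool.eq_iff_iff, adjacency_eq_true, adjacency_eq_true, G.adj_comm]
  simp only [markedEntry, hadj, eq_comm]

theorem card_map_finProdFinEquiv {L : ℕ} (s : Finset (Fin L)) (n : ℕ) :
    #((s ×ˢ (Finset.univ : Finset (Fin n))).map finProdFinEquiv.toEmbedding) = #s * n := by
  simp

section Blocks

variable {L n : ℕ} {κ : Type*} [DecidableEq κ] (d : ℚ) (color : Fin L → Option κ)

theorem isSymm_blowUp_blockEntry {x : Fin n → Fin n → Letter} (hx : ∀ i j, x i j = x j i) :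
    (blowUp (blockEntry d color) x).IsSymm := by
  refine Matrix.IsSymm.ext fun I J => ?_
  unfold blowUp blockEntry
  rw [hx]
  rcases color (finProdFinEquiv.symm I).1 with _ | q <;>
    rcases color (finProdFinEquiv.symm J).1 with _ | q' <;> simp only [eq_comm]

theorem card_revealed_blowUp_blockEntry (x : Fin n → Fin n → Letter) :
    (#{a | (color a).isSome} * n) ^ 2 ≤ #(revealed (blowUp (blockEntry d color) x)) := by
  rw [← card_map_finProdFinEquiv, sq, ← Finset.card_product]
  refine Finset.card_le_card fun ⟨I, J⟩ hIJ => ?_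
  simp only [Finset.mem_product, Finset.mem_map, Finset.mem_filter, Finset.mem_univ, true_and,
    and_true, Prod.exists, Equiv.coe_toEmbedding] at hIJ
  obtain ⟨⟨a, i, ha, rfl⟩, b, j, hb, rfl⟩ := hIJ
  obtain ⟨q, hq⟩ := Option.isSome_iff_exists.1 ha
  obtain ⟨q', hq'⟩ := Option.isSome_iff_exists.1 hb
  refine Finset.mem_filter.2 ⟨Finset.mem_univ _, ?_⟩
  simp only [blowUp_finProdFinEquiv, blockEntry, hq, hq', Option.isSome_some]

theorem card_blowUpColor (χ : Fin n → κ) (q : κ) :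
    #{a | color a = some q} * n ≤ #{I | blowUpColor color χ I = q} := by
  rw [← card_map_finProdFinEquiv]
  refine Finset.card_le_card fun I hI => ?_
  simp only [Finset.mem_product, Finset.mem_map, Finset.mem_filter, Finset.mem_univ, true_and,
    and_true, Prod.exists, Equiv.coe_toEmbedding] at hI
  obtain ⟨a, i, ha, rfl⟩ := hI
  refine Finset.mem_filter.2 ⟨Finset.mem_univ _, ?_⟩
  simp only [blowUpColor, Equiv.symm_apply_apply, ha, Option.getD_some]

theorem completes_blowUp_blockEntry {adj : Fin n → Fin n → Bool} {χ : Fin n → κ}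
    (hχ : ∀ i j, adj i j = true → χ i ≠ χ j) :
    Completes (colorMatrix (d : ℝ) (blowUpColor color χ))
      (blowUp (blockEntry d color) (markedEntry adj)) := by
  intro I J y h
  unfold colorMatrix blowUpColor
  unfold blowUp blockEntry at h
  rcases ha : color (finProdFinEquiv.symm I).1 with _ | q <;>
    rcases hb : color (finProdFinEquiv.symm J).1 with _ | q' <;>
    simp only [ha, hb, reduceCtorEq, Option.some.injEq] at h
  · unfold markedEntry at h
    simp only [Option.getD_none]
    split_ifs at h with hij
    · simp only [vertexEntry, Option.some.injEq] at h
      rw [hij, if_pos rfl, h]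
    · rcases hadj : adj (finProdFinEquiv.symm I).2 (finProdFinEquiv.symm J).2 with _ | _ <;>
        simp only [hadj, vertexEntry, reduceCtorEq, Option.some.injEq] at h
      rw [if_neg (hχ _ _ hadj), ← h, Rat.cast_zero]
  · simp only [Option.getD_some]
    rw [← h]
    split_ifs <;> simp

end Blocks

theorem promise_blowUp_blockEntry {L k r n : ℕ} {p ε c μ : ℝ} {d : ℚ} (hd : 0 < d)
    (hdc : (d : ℝ) ≤ c) {color : Fin L → Option (Fin k)}
    (hne : ∀ q, 0 < #{a | color a = some q})
    (hp : p * (L : ℝ) ^ 2 ≤ (#{a | (color a).isSome} : ℝ) ^ 2) (hμ : 0 ≤ μ)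
    (hcol : ∀ q, (L : ℝ) ≤ k * μ * #{a | color a = some q}) {G : SimpleGraph (Fin n)}
    (hn : 0 < n) (hG : G.Colorable k) :
    (completionProblem k r p ε c μ).Promise
      ⟨L * n, blowUp (blockEntry d color) (markedEntry (adjacency G))⟩ := by
  obtain ⟨χ⟩ := hG
  have hd' : (0 : ℝ) < d := Rat.cast_pos.2 hd
  have hsurj : Function.Surjective (blowUpColor color χ) := fun q => by
    obtain ⟨I, hI⟩ :=
      Finset.card_pos.1 ((Nat.mul_pos (hne q) hn).trans_le (card_blowUpColor color χ q))
    exact ⟨I, (Finset.mem_filter.1 hI).2⟩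
  have hrevealed : p * ((L * n : ℕ) : ℝ) ^ 2 ≤
      #(revealed (blowUp (blockEntry d color) (markedEntry (adjacency G)))) := calc
    p * ((L * n : ℕ) : ℝ) ^ 2 = p * (L : ℝ) ^ 2 * (n : ℝ) ^ 2 := by push_cast; ring
    _ ≤ (#{a | (color a).isSome} : ℝ) ^ 2 * (n : ℝ) ^ 2 := by gcongr
    _ ≤ _ := by
      rw [← mul_pow]
      exact_mod_cast card_revealed_blowUp_blockEntry d color (markedEntry (adjacency G))
  have hclass (q) : ((L * n : ℕ) : ℝ) ≤ k * μ * #{I | blowUpColor color χ I = q} := calc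
    ((L * n : ℕ) : ℝ) ≤ k * μ * #{a | color a = some q} * n := by
      push_cast
      gcongr
      exact hcol q
    _ = k * μ * (#{a | color a = some q} * n : ℕ) := by push_cast; ring
    _ ≤ _ := by gcongr; exact card_blowUpColor color χ q
  refine ⟨isSymm_blowUp_blockEntry d color (markedEntry_adjacency_comm G), hrevealed,
    colorMatrix d (blowUpColor color χ), Matrix.IsSymm.ext fun I J => ?_,
    (rank_colorMatrix hd'.ne' hsurj).trans (Fintype.card_fin k),
    hasCoherence_colorMatrix hd' hsurj hclass, fun I J => ?_,
    completes_blowUp_blockEntry d color fun i j hij => χ.valid (adjacency_eq_true.1 hij)⟩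
  · simp only [colorMatrix, eq_comm]
  · unfold colorMatrix
    split_ifs
    · rwa [abs_of_pos hd']
    · rw [abs_zero]
      exact hd'.le.trans hdc

/-! ### Independent sets from approximate completions -/

/-- The squared error of the value `y` at a position of a partial matrix, `0` where the entry is
hidden. -/
def entryError : Option ℚ → ℝ → ℝ
  | none, _ => 0
  | some q, y => (q - y) ^ 2

theorem entryError_nonneg (x : Option ℚ) (y : ℝ) : 0 ≤ entryError x y := by
  rcases x with _ | q
  · exact le_rfl
  · exact sq_nonneg _

theorem squaredError_eq_sum {n : ℕ} (A : Matrix (Fin n) (Fin n) (Option ℚ))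
    (B : Matrix (Fin n) (Fin n) ℝ) :
    squaredError A B = ∑ i, ∑ j, entryError (A i j) (B i j) := by
  rw [squaredError, revealed, Finset.sum_filter, Fintype.sum_prod_type]
  refine Finset.sum_congr rfl fun i _ => Finset.sum_congr rfl fun j _ => ?_
  rcases A i j with _ | q <;> simp [entryError]

theorem squaredError_blowUp {β : Type*} {L n : ℕ} (ent : Fin L → Fin L → β → Option ℚ)
    (x : Fin n → Fin n → β) (B : Matrix (Fin (L * n)) (Fin (L * n)) ℝ) :
    squaredError (blowUp ent x) B = ∑ ab : Fin L × Fin L, ∑ i, ∑ j,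
      entryError (ent ab.1 ab.2 (x i j))
        (B (finProdFinEquiv (ab.1, i)) (finProdFinEquiv (ab.2, j))) := by
  rw [squaredError_eq_sum, ← finProdFinEquiv.sum_comp, Fintype.sum_prod_type, Fintype.sum_prod_type]
  refine Finset.sum_congr rfl fun a _ => Eq.trans (Finset.sum_congr rfl fun i _ => ?_)
    Finset.sum_comm
  rw [← finProdFinEquiv.sum_comp, Fintype.sum_prod_type]
  simp only [blowUp_finProdFinEquiv]

theorem exists_copies_error_le {L n : ℕ} {κ : Type*} [DecidableEq κ] {d : ℚ}
    {color : Fin L → Option κ} (hcopy : 0 < #{a | color a = none}) {η : ℝ}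
    {x : Fin n → Fin n → Letter} {B : Matrix (Fin (L * n)) (Fin (L * n)) ℝ}
    (hB : squaredError (blowUp (blockEntry d color) x) B ≤
      η * (#{a | color a = none} : ℝ) ^ 2) :
    ∃ a b : Fin L, ∑ i, ∑ j, entryError (vertexEntry d (x i j))
      (B (finProdFinEquiv (a, i)) (finProdFinEquiv (b, j))) ≤ η := by
  set S : Finset (Fin L) := {a | color a = none}
  let W (ab : Fin L × Fin L) : ℝ := ∑ i, ∑ j, entryError (blockEntry d color ab.1 ab.2 (x i j))
    (B (finProdFinEquiv (ab.1, i)) (finProdFinEquiv (ab.2, j)))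
  have hW (ab) : 0 ≤ W ab :=
    Finset.sum_nonneg fun _ _ => Finset.sum_nonneg fun _ _ => entryError_nonneg _ _
  have hS : (S ×ˢ S).Nonempty := (Finset.card_pos.1 hcopy).product (Finset.card_pos.1 hcopy)
  have hle : ∑ ab ∈ S ×ˢ S, W ab ≤ ∑ _ab ∈ S ×ˢ S, η := calc
    ∑ ab ∈ S ×ˢ S, W ab ≤ ∑ ab, W ab :=
      Finset.sum_le_sum_of_subset_of_nonneg (Finset.subset_univ _) fun ab _ _ => hW ab
    _ ≤ η * (#S : ℝ) ^ 2 := squaredError_blowUp (blockEntry d color) x B ▸ hB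
    _ = ∑ _ab ∈ S ×ˢ S, η := by simp [mul_comm, sq]
  obtain ⟨⟨a, b⟩, hab, hη⟩ := Finset.exists_le_of_sum_le hS hle
  obtain ⟨ha, hb⟩ := Finset.mem_product.1 hab
  refine ⟨a, b, ?_⟩
  simpa only [W, blockEntry, (Finset.mem_filter.1 ha).2, (Finset.mem_filter.1 hb).2] using hη

theorem abs_sub_le_of_sum_entryError_le {ι : Type*} [Fintype ι] {x : ι → Option ℚ} {y : ι → ℝ}
    {δ : ℝ} (hδ : 0 ≤ δ) (h : ∑ j, entryError (x j) (y j) ≤ δ ^ 2) {j : ι} {q : ℚ}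
    (hq : x j = some q) : |(q : ℝ) - y j| ≤ δ := by
  have hj : entryError (x j) (y j) ≤ δ ^ 2 :=
    (Finset.single_le_sum (fun j _ => entryError_nonneg (x j) (y j)) (Finset.mem_univ j)).trans h
  rw [hq, entryError] at hj
  exact abs_le_of_sq_le_sq hj hδ

theorem card_le_two_mul_card_filter_le {ι : Type*} [Fintype ι] {w : ι → ℝ} {η : ℝ} (hη : 0 < η)
    (hw : ∀ i, 0 ≤ w i) (hsum : ∑ i, w i ≤ η * Fintype.card ι) :
    Fintype.card ι ≤ 2 * #{i | w i ≤ 2 * η} := by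
  have hlarge : #{i | ¬ w i ≤ 2 * η} * (2 * η) ≤ η * Fintype.card ι := calc
    #{i | ¬ w i ≤ 2 * η} * (2 * η) = ∑ i with ¬ w i ≤ 2 * η, 2 * η := by simp
    _ ≤ ∑ i with ¬ w i ≤ 2 * η, w i :=
      Finset.sum_le_sum fun i hi => (not_le.1 (Finset.mem_filter.1 hi).2).le
    _ ≤ ∑ i, w i := Finset.sum_le_univ_sum_of_nonneg hw
    _ ≤ η * Fintype.card ι := hsum
  have hle : 2 * #{i | ¬ w i ≤ 2 * η} ≤ Fintype.card ι := by
    have : (2 * #{i | ¬ w i ≤ 2 * η} : ℝ) ≤ Fintype.card ι :=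
      le_of_mul_le_mul_left (by linarith) hη
    exact_mod_cast this
  have hsplit := Finset.card_filter_add_card_filter_not (s := Finset.univ) fun i => w i ≤ 2 * η
  rw [Finset.card_univ] at hsplit
  omega

theorem exists_card_le_mul_card_fiber {ι κ : Type*} [Fintype κ] [Nonempty κ] [DecidableEq κ]
    (s : Finset ι) (f : ι → κ) : ∃ q, #s ≤ Fintype.card κ * #{i ∈ s | f i = q} := by
  have hsum : ∑ _q : κ, #s ≤ ∑ q, Fintype.card κ * #{i ∈ s | f i = q} := by
    rw [← Finset.mul_sum,
      ← Finset.card_eq_sum_card_fiberwise fun i _ => Finset.mem_coe.2 (Finset.mem_univ (f i)),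
      Finset.sum_const, Finset.card_univ, smul_eq_mul]
  obtain ⟨q, -, hq⟩ := Finset.exists_le_of_sum_le Finset.univ_nonempty hsum
  exact ⟨q, hq⟩

theorem exists_separating_row {n Q : ℕ} {d : ℚ} {δ : ℝ} (hδ : 0 < δ) (hn : 0 < n)
    {adj : Fin n → Fin n → Bool} {C : Matrix (Fin n) (Fin n) ℝ} {f : Fin n → Fin Q}
    (hf : ∀ i i', f i = f i' → ∀ j, |C i j - C i' j| ≤ δ)
    (hC : ∑ i, ∑ j, entryError (vertexEntry d (markedEntry adj i j)) (C i j) ≤ δ ^ 2 / 2 * n) :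
    ∃ (i₀ : Fin n) (S : Finset (Fin n)), n ≤ 2 * Q * #S ∧ ∀ i ∈ S, d - 2 * δ ≤ C i₀ i ∧
      ∀ j, j ≠ i → adj i j = true → C i₀ j ≤ 2 * δ := by
  let w (i) : ℝ := ∑ j, entryError (vertexEntry d (markedEntry adj i j)) (C i j)
  have hgood : n ≤ 2 * #{i | w i ≤ 2 * (δ ^ 2 / 2)} := by
    simpa only [Fintype.card_fin] using card_le_two_mul_card_filter_le (by positivity)
      (fun i => Finset.sum_nonneg fun _ _ => entryError_nonneg _ _)
      (hC.trans_eq (by rw [Fintype.card_fin]))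
  have : Nonempty (Fin Q) := ⟨f ⟨0, hn⟩⟩
  obtain ⟨q, hq⟩ := exists_card_le_mul_card_fiber {i | w i ≤ 2 * (δ ^ 2 / 2)} f
  set S : Finset (Fin n) := {i ∈ ({i | w i ≤ 2 * (δ ^ 2 / 2)} : Finset (Fin n)) | f i = q}
  have hS : n ≤ 2 * Q * #S := by
    rw [Fintype.card_fin] at hq
    rw [mul_assoc]
    omega
  have hmem {i} (hi : i ∈ S) : w i ≤ δ ^ 2 ∧ f i = q := by
    simpa only [S, Finset.mem_filter, Finset.mem_univ, true_and, mul_div_cancel₀ _ (two_ne_zero' ℝ)]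
      using hi
  obtain ⟨i₀, hi₀⟩ : S.Nonempty :=
    Finset.card_pos.1 (pos_of_mul_pos_right (hn.trans_le hS) (by omega))
  refine ⟨i₀, S, hS, fun i hi => ?_⟩
  have hclass (j) := abs_le.1 (hf i₀ i ((hmem hi₀).2.trans (hmem hi).2.symm) j)
  have herr {j y} (hy : vertexEntry d (markedEntry adj i j) = some y) :=
    abs_le.1 (abs_sub_le_of_sum_entryError_le hδ.le (hmem hi).1 hy)
  refine ⟨?_, fun j hji hij => ?_⟩
  · have hdiag := herr (j := i) (y := d) (by simp [markedEntry, vertexEntry])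
    linarith [hdiag.2, (hclass i).1]
  · have hedge := herr (j := j) (y := 0) (by simp [markedEntry, vertexEntry, hji.symm, hij])
    rw [Rat.cast_zero] at hedge
    linarith [hedge.1, (hclass j).2]

theorem mem_chunks {L n : ℕ} (e : ℕ) (B : Matrix (Fin (L * n)) (Fin (L * n)) ℚ)
    (I : Fin (L * n)) (b : Fin L) :
    (fun j => isLarge e (B I (finProdFinEquiv (b, j)))) ∈ chunks e B :=
  List.mem_flatten.2 ⟨_, (List.mem_ofFn' _ _).2 ⟨I, rfl⟩, (List.mem_ofFn' _ _).2 ⟨b, rfl⟩⟩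

theorem card_le_ones_isolated {n e : ℕ} {adj : Fin n → Fin n → Bool} {y : Fin n → ℚ}
    {S : Finset (Fin n)} (hlarge : ∀ i ∈ S, 1 ≤ y i * 2 ^ e)
    (hsmall : ∀ i ∈ S, ∀ j, j ≠ i → adj i j = true → y j * 2 ^ (e + 1) ≤ 1) :
    #S ≤ ones (bitWord (isolated adj fun j => isLarge e (y j))) := by
  rw [ones_bitWord]
  refine Finset.card_le_card fun i hi => ?_
  rw [Finset.mem_filter, isolated_iff]
  exact ⟨Finset.mem_univ i, isLarge_of_le (hlarge i hi), fun j hji hij =>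
    isLarge_eq_false (hsmall i hi j hji hij)⟩

theorem exists_chunk_of_isSolution {L k r n Q e : ℕ} {κ : Type*} [DecidableEq κ] {p ε c μ : ℝ}
    {color : Fin L → Option κ} (hcopy : 0 < #{a | color a = none})
    (hε : ε * L ≤ (1 / 2 ^ (e + 2)) ^ 2 / 2 * (#{a | color a = none} : ℝ) ^ 2)
    (hQ : ∀ C : Matrix (Fin n) (Fin n) ℝ, C.rank ≤ r → (∀ i j, |C i j| ≤ c) →
      ∃ f : Fin n → Fin Q, ∀ i i', f i = f i' → ∀ j, |C i j - C i' j| ≤ 1 / 2 ^ (e + 2))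
    {adj : Fin n → Fin n → Bool} {B : Matrix (Fin (L * n)) (Fin (L * n)) ℚ} (hn : 0 < n)
    (hB : (completionProblem k r p ε c μ).IsSolution
      ⟨L * n, blowUp (blockEntry (2 / 2 ^ e) color) (markedEntry adj)⟩ B) :
    ∃ q ∈ chunks e B, n ≤ 2 * Q * ones (bitWord (isolated adj q)) := by
  obtain ⟨hrank, hbound, herr⟩ := hB
  have herr' : squaredError (blowUp (blockEntry (2 / 2 ^ e) color) (markedEntry adj))
      (B.map ((↑) : ℚ → ℝ)) ≤
        (1 / 2 ^ (e + 2)) ^ 2 / 2 * n * (#{a | color a = none} : ℝ) ^ 2 := calc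
    _ ≤ ε * ((L * n : ℕ) : ℝ) := herr
    _ = ε * L * n := by push_cast; ring
    _ ≤ (1 / 2 ^ (e + 2)) ^ 2 / 2 * (#{a | color a = none} : ℝ) ^ 2 * n := by gcongr
    _ = _ := by ring
  obtain ⟨a, b, hab⟩ := exists_copies_error_le hcopy herr'
  let C : Matrix (Fin n) (Fin n) ℝ := (B.map ((↑) : ℚ → ℝ)).submatrix
    (fun i => finProdFinEquiv (a, i)) (fun j => finProdFinEquiv (b, j))
  obtain ⟨f, hf⟩ := hQ C ((Matrix.rank_submatrix_le _ _ _).trans hrank) fun i j => hbound _ _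
  obtain ⟨i₀, S, hS, hsep⟩ := exists_separating_row (d := 2 / 2 ^ e) (by positivity) hn hf hab
  let y (j) : ℚ := B (finProdFinEquiv (a, i₀)) (finProdFinEquiv (b, j))
  have hlarge (i) (hi : i ∈ S) : 1 ≤ y i * 2 ^ e := by
    have hy : ((2 / 2 ^ e : ℚ) : ℝ) - 2 * (1 / 2 ^ (e + 2)) ≤ y i := (hsep i hi).1
    have : (1 : ℝ) ≤ y i * 2 ^ e := calc
      (1 : ℝ) ≤ (((2 / 2 ^ e : ℚ) : ℝ) - 2 * (1 / 2 ^ (e + 2))) * 2 ^ e := by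
        push_cast
        rw [pow_add]
        field_simp
        norm_num
      _ ≤ _ := by gcongr
    exact_mod_cast this
  have hsmall (i) (hi : i ∈ S) (j) (hji : j ≠ i) (hij : adj i j = true) :
      y j * 2 ^ (e + 1) ≤ 1 := by
    have hy : (y j : ℝ) ≤ 2 * (1 / 2 ^ (e + 2)) := (hsep i hi).2 j hji hij
    have : (y j : ℝ) * 2 ^ (e + 1) ≤ 1 := calc
      _ ≤ (2 * (1 / 2 ^ (e + 2)) : ℝ) * 2 ^ (e + 1) := by gcongr
      _ = 1 := by field_simp; ring
    exact_mod_cast this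
  exact ⟨_, mem_chunks e B _ b,
    hS.trans (Nat.mul_le_mul_left _ (card_le_ones_isolated hlarge hsmall))⟩

/-! ### Hardness of completion -/

/-- The colors of `t` blocks without a color, followed by `s` blocks of each of `k` colors. -/
def blockColor (t k s : ℕ) : Fin (t + k * s) → Option (Fin k) :=
  Fin.addCases (fun _ => none) fun b => some (finProdFinEquiv.symm b).1

theorem card_filter_blockColor (t k s : ℕ) (P : Option (Fin k) → Prop) [DecidablePred P] :
    #{a | P (blockColor t k s a)} = (if P none then t else 0) + s * #{q | P (some q)} := by
  rw [Finset.card_filter, Fin.sum_univ_add, ← finProdFinEquiv.sum_comp, Fintype.sum_prod_type_right]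
  simp only [blockColor, Fin.addCases_left, Fin.addCases_right, Equiv.symm_apply_apply,
    Finset.sum_const, Finset.card_univ, Fintype.card_fin, smul_eq_mul, mul_ite, mul_one, mul_zero,
    ← Finset.card_filter]

theorem card_blockColor_eq_none (t k s : ℕ) : #{a | blockColor t k s a = none} = t := by
  simp [card_filter_blockColor t k s (· = none)]

theorem card_blockColor_eq_some (t s : ℕ) {k : ℕ} (q : Fin k) :
    #{a | blockColor t k s a = some q} = s := by
  simp [card_filter_blockColor t k s (· = some q), Finset.filter_eq']

theorem card_isSome_blockColor (t k s : ℕ) : #{a | (blockColor t k s a).isSome} = s * k := by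
  simp [card_filter_blockColor t k s (·.isSome = true)]

theorem exists_padding_ratio {p μ : ℝ} (hp : p < 1) (hμ : 1 < μ) :
    ∃ N : ℕ, 0 < N ∧ ∀ x : ℝ, N ≤ x → p * (1 + x) ^ 2 ≤ x ^ 2 ∧ 1 + x ≤ μ * x := by
  obtain ⟨N, hN⟩ := exists_nat_gt (max (2 / (1 - p)) (1 / (μ - 1)))
  have hpN := (le_max_left _ _).trans_lt hN
  have hμN := (le_max_right _ _).trans_lt hN
  rw [div_lt_iff₀' (sub_pos.2 hp)] at hpN
  have hN0 : (0 : ℝ) < N := (one_div_pos.2 (sub_pos.2 hμ)).trans hμN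
  rw [div_lt_iff₀' (sub_pos.2 hμ)] at hμN
  refine ⟨N, Nat.cast_pos.1 hN0, fun x hx => ⟨?_, ?_⟩⟩
  · have : 2 ≤ (1 - p) * (1 + x) := by nlinarith
    nlinarith
  · nlinarith

theorem exists_block_counts {k : ℕ} (hk : 0 < k) (ε : ℝ) {p μ η : ℝ} (hp : p < 1) (hμ : 1 < μ)
    (hη : 0 < η) :
    ∃ t s : ℕ, 0 < t ∧ 0 < s ∧ p * ((t + k * s : ℕ) : ℝ) ^ 2 ≤ ((s * k : ℕ) : ℝ) ^ 2 ∧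
      ((t + k * s : ℕ) : ℝ) ≤ k * μ * s ∧ ε * ((t + k * s : ℕ) : ℝ) ≤ η * (t : ℝ) ^ 2 := by
  obtain ⟨N, hN, hratio⟩ := exists_padding_ratio hp hμ
  obtain ⟨hrevealed, hcoherence⟩ :=
    hratio (N * k) (le_mul_of_one_le_right N.cast_nonneg (Nat.one_le_cast.2 hk))
  obtain ⟨t, ht⟩ := exists_nat_gt (max 0 (ε * (1 + N * k) / η))
  have ht0 : (0 : ℝ) < t := (le_max_left _ _).trans_lt ht
  have herror := (le_max_right _ _).trans_lt ht
  rw [div_lt_iff₀ hη] at herror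
  have hL : ((t + k * (N * t) : ℕ) : ℝ) = t * (1 + N * k) := by push_cast; ring
  refine ⟨t, N * t, Nat.cast_pos.1 ht0, Nat.mul_pos hN (Nat.cast_pos.1 ht0), ?_⟩
  rw [hL]
  refine ⟨?_, ?_, ?_⟩
  · calc p * (t * (1 + N * k) : ℝ) ^ 2 = (t : ℝ) ^ 2 * (p * (1 + N * k) ^ 2) := by ring
      _ ≤ (t : ℝ) ^ 2 * (N * k) ^ 2 := by gcongr
      _ = ((N * t * k : ℕ) : ℝ) ^ 2 := by push_cast; ring
  · calc (t * (1 + N * k) : ℝ) ≤ t * (μ * (N * k)) := by gcongr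
      _ = k * μ * (N * t : ℕ) := by push_cast; ring
  · calc ε * (t * (1 + N * k)) = ε * (1 + N * k) * t := by ring
      _ ≤ t * η * t := by gcongr
      _ = η * t ^ 2 := by ring

theorem theorem1p9_general {k : ℕ} (hk : 0 < k)
    (indepSetHard : ∀ R, k ≤ R → ¬ (independentSetProblem k R).SolvableInPolyTime) (r : ℕ)
    {p ε c μ : ℝ} (hp : p < 1) (hc : 0 < c) (hμ : 1 < μ) :
    ¬ (completionProblem k r p ε c μ).SolvableInPolyTime := by
  intro hsolv
  obtain ⟨e, he⟩ := pow_unbounded_of_one_lt (2 / c) (one_lt_two (α := ℝ))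
  have hdc : ((2 / 2 ^ e : ℚ) : ℝ) ≤ c := by
    push_cast
    exact (div_le_comm₀ (by positivity) hc).2 he.le
  obtain ⟨Q, hQ, hclasses⟩ := exists_row_classes r c (δ := 1 / 2 ^ (e + 2)) (by positivity)
  obtain ⟨t, s, ht, hs, hrevealed, hcoherence, herror⟩ :=
    exists_block_counts hk ε hp hμ (η := (1 / 2 ^ (e + 2)) ^ 2 / 2) (by positivity)
  refine indepSetHard (2 * (Q * k)) (by nlinarith) (solvableInPolyTime_of_blowUp hsolv
    (blockEntry (2 / 2 ^ e) (blockColor t k s)) e (by positivity)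
    (fun n G => promise_blowUp_blockEntry (by positivity) hdc (fun q => ?_) ?_ (by linarith)
      fun q => ?_) fun n G B hn hB => ?_)
  · rwa [card_blockColor_eq_some]
  · rwa [card_isSome_blockColor]
  · rwa [card_blockColor_eq_some]
  · obtain ⟨q, hq, hle⟩ := exists_chunk_of_isSolution (by rwa [card_blockColor_eq_none])
      (by rwa [card_blockColor_eq_none]) (fun C => hclasses C) hn hB
    exact ⟨q, hq, hle.trans (by gcongr; exact Nat.le_mul_of_pos_right Q hk)⟩

theorem theorem1p9
    (indepSetHard : ∀ k r : ℕ, 3 ≤ k → k ≤ r → ¬ (independentSetProblem k r).SolvableInPolyTime) :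
    ∃ μ : ℝ, ∀ (k r : ℕ) (c ε : ℝ), 4 ≤ k → k < r → 0 < c → 0 < ε → ε < 1 / (2 * c * r) ^ 2 →
      ¬ (completionProblem k r 0.9 ε c μ).SolvableInPolyTime :=
  ⟨2, fun k r _ _ hk _ hc _ _ => theorem1p9_general (by omega)
    (fun R => indepSetHard k R (by omega)) r (by norm_num) hc one_lt_two⟩
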